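/- Let $K$ be a commutative ring (for instance $\mathbb{C}$, or a ring of polynomials in formal parameters) and $q_c,q_s\in K$, $q_t\in\{0,1\}\subset K$. **Diagrams.** A labelled diagram $d\in\mathbf{ldiag}$ is a bipartite multigraph on black spots $1,\dots,p$ and white spots $1,\dots,q$ without isolated vertex, i.e. a packed matrix $(d(i,j))\in\mathbb{N}^{p\times q}$ (no zero row, no zero column); $d(i,j)$ is the number of lines between $i$ and $j$. Diagrams form a monoid under concatenation $[d|e]$ (block diagonal matrix), with the empty diagram as unit; $\mathrm{irr}$ denotes the set of its irreducible elements (the connected packed matrices). The code of $d$ is the list of monomials $\varphi(d)=[m_1,\dots,m_p]$, $m_i=\prod_j x_j^{d(i,j)}$. **Product.** On the free module on lists of non-unit monomials in $x_1,x_2,\dots$ (with $|m|$ the total degree of a monomial, extended additively to lists, and $a*u$ the list $u$ with $a$ put in front) let $w\uparrow[\,]=[\,]\uparrow w=w$ and $$a*u\uparrow b*v=a*(u\uparrow b*v)+q_c^{|a*u||b|}\,b*(a*u\uparrow v)+q_c^{|u||b|}q_s^{|a||b|}\,ab*(u\uparrow v),$$ and $u\mathbin{\bar\uparrow}v=u\uparrow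 T^n(v)$, where $n$ is the highest index of a variable in $u$ and $T(x_i)=x_{i+1}$. The span of the codes of diagrams is closed under $\bar\uparrow$; $\mathbf{LDIAG}(q_c,q_s)$ is $K[\mathbf{ldiag}]$ with the law transported from it through $\varphi$. **Reference structures.** $\mathbf{LDIAG}$ is $K[\mathbf{ldiag}]$ with concatenation and the coproduct $\Delta_{BS}(d)=\sum_{I+J=[1..p]}d[I]\otimes d[J]$, where $d[I]$ is the restriction of $d$ to the black spots in $I$ (white spots that become isolated are deleted); $\Delta_{WS}$ is defined likewise with white spots. $\mathbf{MQSym}$ is the free module on $MS_P$, $P$ a packed matrix, where $MS_P\,MS_Q$ is the sum of all $MS_{[P'|Q']}$ with $P'$, $Q'$ obtained from $P$, $Q$ by inserting zero rows so that they have the same number of rows and $[P'|Q']$ has no zero row, and $\Delta_{\mathbf{MQSym}}(MS_P)$ is the sum, over all ways to cut $P$ between rows into an upper part $P_1$ and a lower part $P_2$, of $MS_{\mathrm{pack}(P_1)}\otimes MS_{\mathrm{pack}(P_2)}$, where $\mathrm{pack}$ deletes zero rows and columns. In all these structures the counit $\varepsilon$ is the coefficient of the empty diagram. **Coproduct.**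 Fix $\Delta_0$ to be either $\Delta_{WS}$ or $\Delta_{BS}$. For $d\in\mathrm{irr}$ write, over words in the free generators $\mathrm{irr}$, $$\Delta_0(d)=\sum\beta_d^{u,v}\,[u_1|\cdots|u_k]\otimes[v_1|\cdots|v_l],\qquad \Delta_{\mathbf{MQSym}}(MS_d)=\sum\alpha_d^{u,v}\,MS_{u_1}\cdots MS_{u_k}\otimes MS_{v_1}\cdots MS_{v_l}.$$ Then $\Delta_{q_t}$ is the morphism of unital algebras $\mathbf{LDIAG}(q_c,q_s)\to\mathbf{LDIAG}(q_c,q_s)^{\otimes2}$ (untwisted tensor product) such that for all $d\in\mathrm{irr}$ $$\Delta_{q_t}(d)=\sum\big((1-q_t)\beta_d^{u,v}+q_t\alpha_d^{u,v}\big)\,(u_1\mathbin{\bar\uparrow}\cdots\mathbin{\bar\uparrow}u_k)\otimes(v_1\mathbin{\bar\uparrow}\cdots\mathbin{\bar\uparrow}v_l).$$ **Claim.** i) There is exactly one such $\Delta_{q_t}$, and $\mathbf{LDIAG}(q_c,q_s,q_t):=(K[\mathbf{ldiag}],\bar\uparrow,1_{\mathbf{ldiag}},\Delta_{q_t},\varepsilon)$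 is a Hopf algebra. ii) $\mathbf{LDIAG}(0,0,0)\simeq\mathbf{LDIAG}$ as Hopf algebras. iii) $\mathbf{LDIAG}(1,1,1)\simeq\mathbf{MQSym}$ as Hopf algebras. -/

import Mathlib

universe u

open scoped TensorProduct

noncomputable section

namespace Feynman

/-! Labelled diagrams -/

/-- A labelled diagram: a bipartite multigraph on the black spots `1, …, p` and the white spots
`1, …, q` (indexed here from `0`), without isolated vertex; `m i j` is the number of lines from
the black spot `i` to the white spot `j`. The multiplicity matrix `m` is exactly a packed matrix
(entries in `ℕ`, no zero row, no zero column). -/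
@[ext]
structure LDiag where
  p : ℕ
  q : ℕ
  m : Fin p → Fin q → ℕ
  row_ne : ∀ i, ∃ j, m i j ≠ 0
  col_ne : ∀ j, ∃ i, m i j ≠ 0

/-- The empty diagram. -/
def LDiag.empty : LDiag where
  p := 0
  q := 0
  m := fun i => i.elim0
  row_ne := fun i => i.elim0
  col_ne := fun j => j.elim0

/-- Concatenation `[d|e]`: the spots of `e` are relabelled after those of `d`
(block diagonal matrix). -/
def LDiag.concat (d e : LDiag) : LDiag where
  p := d.p + e.p
  q := d.q + e.q
  m := Fin.addCases (fun i => Fin.addCases (fun j => d.m i j) (fun _ => 0))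
    (fun i => Fin.addCases (fun _ => 0) (fun j => e.m i j))
  row_ne := by
    intro i
    refine Fin.addCases (fun i => ?_) (fun i => ?_) i
    · obtain ⟨j, hj⟩ := d.row_ne i
      exact ⟨Fin.castAdd _ j, by simpa using hj⟩
    · obtain ⟨j, hj⟩ := e.row_ne i
      exact ⟨Fin.natAdd _ j, by simpa using hj⟩
  col_ne := by
    intro j
    refine Fin.addCases (fun j => ?_) (fun j => ?_) j
    · obtain ⟨i, hi⟩ := d.col_ne j
      exact ⟨Fin.castAdd _ i, by simpa using hi⟩
    · obtain ⟨i, hi⟩ := e.col_ne j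
      exact ⟨Fin.natAdd _ i, by simpa using hi⟩

/-- Irreducible elements of the monoid of labelled diagrams (connected packed matrices). -/
def LDiag.IsIrreducible (d : LDiag) : Prop :=
  d ≠ LDiag.empty ∧ ∀ y z : LDiag, d = y.concat z → y = LDiag.empty ∨ z = LDiag.empty

/-- The set of irreducible diagrams. -/
def Irr : Type := {d : LDiag // d.IsIrreducible}

open Classical in
/-- The packed matrix obtained from a matrix by deleting its zero rows and zero columns. -/
def LDiag.pack {p q : ℕ} (m : Fin p → Fin q → ℕ) : LDiag where
  p := (Finset.univ.filter fun i => ∃ j, m i j ≠ 0).card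
  q := (Finset.univ.filter fun j => ∃ i, m i j ≠ 0).card
  m := fun i j => m ((Finset.univ.filter fun i => ∃ j, m i j ≠ 0).orderEmbOfFin rfl i)
    ((Finset.univ.filter fun j => ∃ i, m i j ≠ 0).orderEmbOfFin rfl j)
  row_ne := by
    intro i
    have hi := Finset.orderEmbOfFin_mem (Finset.univ.filter fun i => ∃ j, m i j ≠ 0) rfl i
    obtain ⟨j, hj⟩ := (Finset.mem_filter.1 hi).2
    have hmem : j ∈ Finset.univ.filter fun j => ∃ i, m i j ≠ 0 :=
      Finset.mem_filter.2 ⟨Finset.mem_univ _, _, hj⟩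
    rw [← Finset.mem_coe, ← Finset.range_orderEmbOfFin _ rfl] at hmem
    obtain ⟨j', rfl⟩ := hmem
    exact ⟨j', hj⟩
  col_ne := by
    intro j
    have hj := Finset.orderEmbOfFin_mem (Finset.univ.filter fun j => ∃ i, m i j ≠ 0) rfl j
    obtain ⟨i, hi⟩ := (Finset.mem_filter.1 hj).2
    have hmem : i ∈ Finset.univ.filter fun i => ∃ j, m i j ≠ 0 :=
      Finset.mem_filter.2 ⟨Finset.mem_univ _, _, hi⟩
    rw [← Finset.mem_coe, ← Finset.range_orderEmbOfFin _ rfl] at hmem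
    obtain ⟨i', rfl⟩ := hmem
    exact ⟨i', hi⟩

open Classical in
/-- Restriction `d[I]` to the set `I` of black spots: the other black spots are removed, together
with the white spots that become isolated. -/
def LDiag.restrictBlack (d : LDiag) (I : Finset (Fin d.p)) : LDiag :=
  LDiag.pack fun i j => if i ∈ I then d.m i j else 0

open Classical in
/-- Restriction of `d` to the set `J` of white spots. -/
def LDiag.restrictWhite (d : LDiag) (J : Finset (Fin d.q)) : LDiag :=
  LDiag.pack fun i j => if j ∈ J then d.m i j else 0

/-! Lists of monomials and the deformed law -/

/-- Commutative monomials in `x₁, x₂, …`, as exponent functions (`x_{j+1}` has index `j`);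
the product of monomials is the sum of exponents. -/
abbrev Mon : Type := ℕ →₀ ℕ

/-- The total weight of a list of monomials. -/
def listWeight (l : List Mon) : ℕ := (l.map Finsupp.degree).sum

/-- The highest index (counted from `1`) of a variable occurring in a list, `0` if there is none. -/
def maxIndex (l : List Mon) : ℕ := l.foldr (fun a n => max (a.support.sup (· + 1)) n) 0

/-- The translation `x_i ↦ x_{i+n}` on lists of monomials. -/
def translate (n : ℕ) (l : List Mon) : List Mon :=
  l.map fun a => Finsupp.mapDomain (· + n) a

/-- The code of a diagram: the list of the monomials `∏_j x_j ^ m(i,j)`, `i = 1, …, p`. -/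
def LDiag.code (d : LDiag) : List Mon :=
  List.ofFn fun i : Fin d.p => ∑ j : Fin d.q, Finsupp.single (j : ℕ) (d.m i j)

variable {K : Type*} [CommRing K]

/-- The twisted law `↑` on lists of monomials. -/
def twisted (qc qs : K) : List Mon → List Mon → (List Mon →₀ K)
  | [], w => Finsupp.single w 1
  | a :: u, [] => Finsupp.single (a :: u) 1
  | a :: u, b :: v =>
      Finsupp.mapDomain (List.cons a) (twisted qc qs u (b :: v))
      + qc ^ (listWeight (a :: u) * Finsupp.degree b) •
          Finsupp.mapDomain (List.cons b) (twisted qc qs (a :: u) v)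
      + (qc ^ (listWeight u * Finsupp.degree b) * qs ^ (Finsupp.degree a * Finsupp.degree b)) •
          Finsupp.mapDomain (List.cons (a + b)) (twisted qc qs u v)
termination_by u v => u.length + v.length

/-- The shifted twisted law on lists: `u ↑ T^n(v)`, `n` the highest index occurring in `u`. -/
def shiftedTwisted (qc qs : K) (u v : List Mon) : List Mon →₀ K :=
  twisted qc qs u (translate (maxIndex u) v)

theorem LDiag.code_apply (d : LDiag) (i : Fin d.p) (k : ℕ) :
    (∑ j : Fin d.q, Finsupp.single (j : ℕ) (d.m i j)) k =
      if h : k < d.q then d.m i ⟨k, h⟩ else 0 := by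
  rw [Finsupp.finsetSum_apply]
  split_ifs with h
  · rw [Finset.sum_eq_single ⟨k, h⟩]
    · simp
    · intro b _ hb
      rw [Finsupp.single_apply, if_neg]
      exact fun e => hb (Fin.ext e)
    · simp
  · refine Finset.sum_eq_zero fun j _ => ?_
    rw [Finsupp.single_apply, if_neg]
    intro e
    exact h (e ▸ j.2)

theorem LDiag.code_injective : Function.Injective LDiag.code := by
  have key : ∀ d e : LDiag, d.code = e.code → d.q ≤ e.q := by
    intro d e h
    by_contra hlt
    push Not at hlt
    obtain ⟨i, hi⟩ := d.col_ne ⟨e.q, hlt⟩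
    have hlen : d.p = e.p := by simpa [LDiag.code] using congrArg List.length h
    have := List.ofFn_inj'.1 h
    obtain ⟨p, q, m, h1, h2⟩ := d
    obtain ⟨p', q', m', h1', h2'⟩ := e
    dsimp only at *
    subst hlen
    have hf := congrFun (eq_of_heq (Sigma.mk.inj this).2) i
    have hk := DFunLike.congr_fun hf q'
    have e1 := LDiag.code_apply ⟨p, q, m, h1, h2⟩ i q'
    have e2 := LDiag.code_apply ⟨p, q', m', h1', h2'⟩ i q'
    dsimp only at e1 e2
    rw [e1, e2] at hk
    simp [hlt] at hk
    exact hi hk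
  intro d e h
  have hlen : d.p = e.p := by simpa [LDiag.code] using congrArg List.length h
  have hq : d.q = e.q := le_antisymm (key d e h) (key e d h.symm)
  have := List.ofFn_inj'.1 h
  obtain ⟨p, q, m, h1, h2⟩ := d
  obtain ⟨p', q', m', h1', h2'⟩ := e
  dsimp only at *
  subst hlen
  subst hq
  have : m = m' := by
    funext i j
    have hf := congrFun (eq_of_heq (Sigma.mk.inj this).2) i
    have hk := DFunLike.congr_fun hf (j : ℕ)
    have e1 := LDiag.code_apply ⟨p, q, m, h1, h2⟩ i j
    have e2 := LDiag.code_apply ⟨p, q, m', h1', h2'⟩ i j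
    dsimp only at e1 e2
    rw [e1, e2] at hk
    simpa using hk
  subst this
  rfl

/-! Algebra-coalgebra structures on the free module on labelled diagrams -/

variable (K) in
/-- The operations of a (candidate) Hopf algebra on the free module with basis the labelled
diagrams (equivalently the packed matrices). No law is included: whether the laws hold is the
content of `IsHopfAlgebra`. -/
structure HopfOps where
  mul : (LDiag →₀ K) →ₗ[K] (LDiag →₀ K) →ₗ[K] (LDiag →₀ K)
  one : LDiag →₀ K
  comul : (LDiag →₀ K) →ₗ[K] (LDiag →₀ K) ⊗[K] (LDiag →₀ K)
  counit : (LDiag →₀ K) →ₗ[K] K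

/-- The operations are those of a Hopf algebra over `K` (in the sense of Mathlib): they are
carried by some linear bijection onto the operations of a Hopf algebra. -/
def HopfOps.IsHopfAlgebra {K : Type u} [CommRing K] (A : HopfOps K) : Prop :=
  ∃ (H : Type u) (_ : Ring H) (_ : HopfAlgebra K H) (e : (LDiag →₀ K) ≃ₗ[K] H),
    (∀ x y, e (A.mul x y) = e x * e y) ∧
    e A.one = 1 ∧
    (∀ x, Coalgebra.comul (R := K) (e x) =
      TensorProduct.map e.toLinearMap e.toLinearMap (A.comul x)) ∧
    (∀ x, Coalgebra.counit (R := K) (e x) = A.counit x)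

/-- Isomorphism of two such structures (for Hopf algebras: isomorphism of Hopf algebras, as the
antipode is determined by the other operations). -/
def HopfOps.IsIsomorphic (A B : HopfOps K) : Prop :=
  ∃ e : (LDiag →₀ K) ≃ₗ[K] (LDiag →₀ K),
    (∀ x y, e (A.mul x y) = B.mul (e x) (e y)) ∧
    e A.one = B.one ∧
    (∀ x, B.comul (e x) = TensorProduct.map e.toLinearMap e.toLinearMap (A.comul x)) ∧
    (∀ x, B.counit (e x) = A.counit x)

/-- The product, in `A`, of a word of irreducible diagrams, extended linearly to the free algebra
on the irreducible diagrams. -/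
def HopfOps.wordProd (A : HopfOps K) : (List Irr →₀ K) →ₗ[K] (LDiag →₀ K) :=
  Finsupp.linearCombination K fun w : List Irr =>
    w.foldr (fun d x => A.mul (Finsupp.single d.1 1) x) A.one

/-- `t = ∑ α^{u,v} u ⊗ v` (over words `u`, `v` of irreducible diagrams) expresses the coproduct
`Δ_A(d)` in terms of the generators of `A`, the irreducible diagrams:
`Δ_A(d) = ∑ α^{u,v} u_A ⊗ v_A`, where `u_A` is the product in `A` of the letters of `u`. -/
def HopfOps.IsExpansion (A : HopfOps K) (d : Irr)
    (t : (List Irr →₀ K) ⊗[K] (List Irr →₀ K)) : Prop :=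
  TensorProduct.map A.wordProd A.wordProd t = A.comul (Finsupp.single d.1 1)

/-- The constant-term linear form: the coefficient of the empty diagram. -/
def constTerm : (LDiag →₀ K) →ₗ[K] K := Finsupp.lapply LDiag.empty

/-- Bilinear extension of a law given on diagrams. -/
def bilin (f : LDiag → LDiag → (LDiag →₀ K)) :
    (LDiag →₀ K) →ₗ[K] (LDiag →₀ K) →ₗ[K] (LDiag →₀ K) :=
  Finsupp.linearCombination K fun d : LDiag => Finsupp.linearCombination K (f d)

/-! The non-deformed Hopf algebra -/

/-- The colour of the spots along which a diagram is split by the coproduct. -/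
inductive Colour where
  | black
  | white

/-- `∑_{I + J = spots} d[I] ⊗ d[J]`, over the black (resp. white) spots of `d`. -/
def spotComul (c : Colour) (d : LDiag) : (LDiag →₀ K) ⊗[K] (LDiag →₀ K) :=
  match c with
  | .black => ∑ I : Finset (Fin d.p),
      Finsupp.single (d.restrictBlack I) 1 ⊗ₜ[K] Finsupp.single (d.restrictBlack Iᶜ) 1
  | .white => ∑ J : Finset (Fin d.q),
      Finsupp.single (d.restrictWhite J) 1 ⊗ₜ[K] Finsupp.single (d.restrictWhite Jᶜ) 1

variable (K) in
/-- Concatenation of diagrams together with the coproduct that splits the spots of colour `c`. -/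
def ldiagOf (c : Colour) : HopfOps K where
  mul := bilin fun d e => Finsupp.single (d.concat e) 1
  one := Finsupp.single LDiag.empty 1
  comul := Finsupp.linearCombination K (spotComul c)
  counit := constTerm

variable (K) in
/-- The Hopf algebra `LDIAG`: concatenation and the coproduct that splits the black spots. -/
def ldiag : HopfOps K := ldiagOf K .black

/-! Matrix quasi-symmetric functions -/

/-- The ways to insert zero rows in a matrix with `p` rows and in one with `p'` rows, so that both
get `r` rows and no row index is inserted in both: the original rows go, in order, to the
positions `f` (resp. `g`). -/
def RowInsertion (p p' r : ℕ) : Type :=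
  {fg : (Fin p → Fin r) × (Fin p' → Fin r) //
    StrictMono fg.1 ∧ StrictMono fg.2 ∧ ∀ k, (∃ i, fg.1 i = k) ∨ ∃ i, fg.2 i = k}

instance (p p' r : ℕ) : Finite (RowInsertion p p' r) := Subtype.finite

instance (p p' r : ℕ) : Fintype (RowInsertion p p' r) := Fintype.ofFinite _

/-- The packed matrix `[P' | Q']`, where `P'` and `Q'` come from `P` and `Q` by insertion of
zero rows. -/
def LDiag.augment (P Q : LDiag) {r : ℕ} (s : RowInsertion P.p Q.p r) : LDiag where
  p := r
  q := P.q + Q.q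
  m := fun k => Fin.addCases (fun j => ∑ i, if s.1.1 i = k then P.m i j else 0)
    (fun j => ∑ i, if s.1.2 i = k then Q.m i j else 0)
  row_ne := by
    intro k
    rcases s.2.2.2 k with ⟨i, hi⟩ | ⟨i, hi⟩
    · obtain ⟨j, hj⟩ := P.row_ne i
      refine ⟨Fin.castAdd _ j, ?_⟩
      simp only [Fin.addCases_left, ne_eq, Finset.sum_eq_zero_iff, not_forall]
      exact ⟨i, Finset.mem_univ _, by simpa [hi] using hj⟩
    · obtain ⟨j, hj⟩ := Q.row_ne i
      refine ⟨Fin.natAdd _ j, ?_⟩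
      simp only [Fin.addCases_right, ne_eq, Finset.sum_eq_zero_iff, not_forall]
      exact ⟨i, Finset.mem_univ _, by simpa [hi] using hj⟩
  col_ne := by
    intro j
    refine Fin.addCases (fun j => ?_) (fun j => ?_) j
    · obtain ⟨i, hi⟩ := P.col_ne j
      refine ⟨s.1.1 i, ?_⟩
      simp only [Fin.addCases_left, ne_eq, Finset.sum_eq_zero_iff, not_forall]
      exact ⟨i, Finset.mem_univ _, by simpa using hi⟩
    · obtain ⟨i, hi⟩ := Q.col_ne j
      refine ⟨s.1.2 i, ?_⟩
      simp only [Fin.addCases_right, ne_eq, Finset.sum_eq_zero_iff, not_forall]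
      exact ⟨i, Finset.mem_univ _, by simpa using hi⟩

variable (K) in
/-- The Hopf algebra `MQSym` on its basis `MS_P`, `P` a packed matrix (the basis vector `P` here).
The product `MS_P MS_Q` is the sum over the augmented shuffle of `P` and `Q`; the coproduct of
`MS_P` cuts `P` between two consecutive rows in all possible ways, the two parts being packed.
Matrices are indexed so that rows are shuffled and cut, the monomials of the code of a diagram
being rows; the convention with columns differs by the transposition of all matrices. -/
def mqsym : HopfOps K where
  mul := bilin fun P Q => ∑ r ∈ Finset.range (P.p + Q.p + 1),
    ∑ s : RowInsertion P.p Q.p r, Finsupp.single (P.augment Q s) 1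
  one := Finsupp.single LDiag.empty 1
  comul := Finsupp.linearCombination K fun P : LDiag => ∑ t ∈ Finset.range (P.p + 1),
    Finsupp.single (P.restrictBlack (Finset.univ.filter fun i => (i : ℕ) < t)) 1 ⊗ₜ[K]
      Finsupp.single (P.restrictBlack (Finset.univ.filter fun i => t ≤ (i : ℕ))) 1
  counit := constTerm

/-! The deformed structures -/

/-- The shifted twisted product on diagrams: the coefficient of `f` in the product of `d` and `e`
is the coefficient of the code of `f` in the product of the codes. -/
def deformedMul (qc qs : K) :
    (LDiag →₀ K) →ₗ[K] (LDiag →₀ K) →ₗ[K] (LDiag →₀ K) :=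
  bilin fun d e => Finsupp.comapDomain LDiag.code (shiftedTwisted qc qs d.code e.code)
    LDiag.code_injective.injOn

/-- `LDIAG(q_c, q_s)` equipped with a coproduct `Δ` and the constant-term counit. -/
def ldiagDeformed (qc qs : K)
    (Δ : (LDiag →₀ K) →ₗ[K] (LDiag →₀ K) ⊗[K] (LDiag →₀ K)) : HopfOps K where
  mul := deformedMul qc qs
  one := Finsupp.single LDiag.empty 1
  comul := Δ
  counit := constTerm

/-- `Δ` is the coproduct `Δ_{q_t}` of `LDIAG(q_c, q_s)`: it is a morphism of unital algebras (for
the untwisted product on the tensor square), and on the irreducible diagrams, which are free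
generators, it is `(1 - q_t) Δ₀ + q_t Δ₁`, where `Δ₀` and `Δ₁` are given by the structure
constants of the coproducts of the non-deformed algebra of diagrams and of `MQSym`, expressed in
their own free generators indexed by the irreducible diagrams. -/
structure IsDeformedComul (c : Colour) (qc qs qt : K)
    (Δ : (LDiag →₀ K) →ₗ[K] (LDiag →₀ K) ⊗[K] (LDiag →₀ K)) : Prop where
  map_one : Δ (Finsupp.single LDiag.empty 1) =
    Finsupp.single LDiag.empty 1 ⊗ₜ[K] Finsupp.single LDiag.empty 1
  map_mul : ∀ x y, Δ (deformedMul qc qs x y) =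
    TensorProduct.map₂ (deformedMul qc qs) (deformedMul qc qs) (Δ x) (Δ y)
  map_irr : ∀ d : Irr, ∃ t₀ t₁ : (List Irr →₀ K) ⊗[K] (List Irr →₀ K),
    (ldiagOf K c).IsExpansion d t₀ ∧ (mqsym K).IsExpansion d t₁ ∧
    Δ (Finsupp.single d.1 1) =
      TensorProduct.map (ldiagDeformed qc qs Δ).wordProd (ldiagDeformed qc qs Δ).wordProd
        ((1 - qt) • t₀ + qt • t₁)

end Feynman

end

/-! The decisive fact is that, for all `q_c` and `q_s`, the algebra `LDIAG(q_c, q_s)` is free on the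
irreducible diagrams. Diagrams form a free monoid on them under concatenation (`concWord_injective`,
`concWord_surjective`), and the deformed product of two diagrams is their concatenation plus
diagrams whose codes have a smaller `nonInv`. Products of irreducible diagrams are therefore
unitriangular with respect to concatenations, hence a basis (`wordProd_bijective`).

Both reference structures live on such algebras. Concatenation is the law at `(0, 0)`
(`ldiagOf_mul`), because non-unit monomials have positive degree; the product of `MQSym` is the law
at `(1, 1)` (`mqsym_mul`), because augmented shuffles of rows are quasi-shuffles of codes. Two free
algebras on the same generators are related by a unique algebra isomorphism that fixes the
generators (`comparison`). A coproduct prescribed on generators by the structure constants of a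
reference structure `B` is then the coproduct of `B` transported along this isomorphism
(`eq_transportComul`). Existence, uniqueness and an isomorphism with `B` follow at once for `q_t =
0` and `q_t = 1`, for every `q_c` and `q_s`; the parameters `(0, 0)` and `(1, 1)` of the last two
claims are special cases.

There remains to see that the reference structures are Hopf algebras. Their coproducts come from
splittings of codes: unshuffling for black spots, deconcatenation for `MQSym`.
`isConnectedBialgebra_of_isSplitting` turns coassociativity and multiplicativity on lists into the
bialgebra laws on diagrams, and the white-spot coproduct follows from the black one by
transposition. The antipode is a geometric series in the convolution algebra, locally finite because
the coproduct preserves the number of black spots (`hopfAlgebraOfConnected`). -/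

noncomputable section

namespace Feynman

variable {K : Type*} [CommRing K]

/-! ### Quasi-shuffles of lists of monomials -/

/-- `QShuffle u v w`: the list `w` is a quasi-shuffle of `u` and `v`. -/
inductive QShuffle : List Mon → List Mon → List Mon → Prop
  | nil_left (w) : QShuffle [] w w
  | nil_right (w) : QShuffle w [] w
  | left {a u b v w} : QShuffle u (b :: v) w → QShuffle (a :: u) (b :: v) (a :: w)
  | right {a u b v w} : QShuffle (a :: u) v w → QShuffle (a :: u) (b :: v) (b :: w)
  | both {a u b v w} : QShuffle u v w → QShuffle (a :: u) (b :: v) ((a + b) :: w)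

variable (K) in
/-- Putting a monomial in front of lists, linearly. -/
def consL (a : Mon) : (List Mon →₀ K) →ₗ[K] (List Mon →₀ K) :=
  Finsupp.lmapDomain K K (List.cons a)

@[simp]
theorem consL_single (a : Mon) (u : List Mon) (r : K) :
    consL K a (Finsupp.single u r) = Finsupp.single (a :: u) r := by
  simp [consL]

theorem twisted_nil_left (qc qs : K) (w : List Mon) :
    twisted qc qs [] w = Finsupp.single w 1 := by
  rw [twisted]

theorem twisted_nil_right (qc qs : K) (w : List Mon) :
    twisted qc qs w [] = Finsupp.single w 1 := by
  cases w <;> rw [twisted]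

theorem twisted_cons_cons (qc qs : K) (a b : Mon) (u v : List Mon) :
    twisted qc qs (a :: u) (b :: v) =
      consL K a (twisted qc qs u (b :: v))
      + qc ^ (listWeight (a :: u) * b.degree) • consL K b (twisted qc qs (a :: u) v)
      + (qc ^ (listWeight u * b.degree) * qs ^ (a.degree * b.degree)) •
          consL K (a + b) (twisted qc qs u v) := by
  rw [twisted]; rfl

/-- Induction along the recursion that defines the twisted law. -/
theorem twisted_induction {motive : List Mon → List Mon → Prop}
    (nil_left : ∀ w, motive [] w) (nil_right : ∀ w, motive w [])
    (cons : ∀ a u b v, motive u (b :: v) → motive (a :: u) v → motive u v →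
      motive (a :: u) (b :: v)) (u v : List Mon) : motive u v := by
  induction u generalizing v with
  | nil => exact nil_left v
  | cons a u ihu =>
    induction v with
    | nil => exact nil_right _
    | cons b v ihv => exact cons a u b v (ihu _) ihv (ihu _)

theorem consL_mem_supported {s t : Set (List Mon)} {a : Mon} (h : ∀ w ∈ s, a :: w ∈ t)
    {x : List Mon →₀ K} (hx : x ∈ Finsupp.supported K K s) :
    consL K a x ∈ Finsupp.supported K K t := by
  classical
  rw [Finsupp.mem_supported] at hx ⊢
  intro w hw
  obtain ⟨y, hy, rfl⟩ := Finset.mem_image.1 (Finsupp.mapDomain_support hw)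
  exact h _ (hx hy)

/-- Questions about weights, variables or lengths of the terms of a product thus become inductions
on `QShuffle`, free of coefficients. -/
theorem twisted_mem_supported (qc qs : K) (u v : List Mon) :
    twisted qc qs u v ∈ Finsupp.supported K K {w | QShuffle u v w} := by
  induction u, v using twisted_induction with
  | nil_left w =>
    rw [twisted_nil_left]; exact Finsupp.single_mem_supported _ _ (QShuffle.nil_left w)
  | nil_right w =>
    rw [twisted_nil_right]; exact Finsupp.single_mem_supported _ _ (QShuffle.nil_right w)
  | cons a u b v h1 h2 h3 =>
    rw [twisted_cons_cons]
    refine add_mem (add_mem (consL_mem_supported (fun _ => QShuffle.left) h1)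
      (Submodule.smul_mem _ _ (consL_mem_supported (fun _ => QShuffle.right) h2)))
      (Submodule.smul_mem _ _ (consL_mem_supported (fun _ => QShuffle.both) h3))

/-! ### The twisted law as a bilinear map -/

/-- The bilinear extension of the twisted law. -/
def tw (qc qs : K) : (List Mon →₀ K) →ₗ[K] (List Mon →₀ K) →ₗ[K] (List Mon →₀ K) :=
  Finsupp.linearCombination K fun u => Finsupp.linearCombination K (twisted qc qs u)

@[simp]
theorem tw_single (qc qs : K) (u v : List Mon) :
    tw qc qs (Finsupp.single u 1) (Finsupp.single v 1) = twisted qc qs u v := by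
  simp [tw]

/-- Two linear maps agree on the elements supported in `s` if they agree on `s`. -/
theorem eq_of_mem_supported {ι M : Type*} [AddCommMonoid M] [Module K M] {s : Set ι}
    {f g : (ι →₀ K) →ₗ[K] M}
    (h : ∀ i ∈ s, f (Finsupp.single i 1) = g (Finsupp.single i 1)) {x : ι →₀ K}
    (hx : x ∈ Finsupp.supported K K s) : f x = g x := by
  rw [Finsupp.mem_supported] at hx
  rw [← Finsupp.sum_single x, Finsupp.sum, map_sum, map_sum]
  refine Finset.sum_congr rfl fun i hi => ?_
  rw [← mul_one (x i), ← smul_eq_mul, ← Finsupp.smul_single, map_smul, map_smul, h i (hx hi)]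

@[simp]
theorem listWeight_nil : listWeight [] = 0 := rfl

@[simp]
theorem listWeight_cons (a : Mon) (u : List Mon) :
    listWeight (a :: u) = a.degree + listWeight u := by
  simp [listWeight]

theorem QShuffle.listWeight_eq {u v w : List Mon} (h : QShuffle u v w) :
    listWeight w = listWeight u + listWeight v := by
  induction h with
  | nil_left | nil_right => simp
  | left _ ih | right _ ih => simp only [listWeight_cons] at ih ⊢; omega
  | both _ ih => simp only [listWeight_cons, map_add] at ih ⊢; omega

theorem tw_cons_left (qc qs : K) (a b : Mon) (u : List Mon) (y : List Mon →₀ K) :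
    tw qc qs (Finsupp.single (a :: u) 1) (consL K b y) =
      consL K a (tw qc qs (Finsupp.single u 1) (consL K b y))
      + qc ^ (listWeight (a :: u) * b.degree) • consL K b (tw qc qs (Finsupp.single (a :: u) 1) y)
      + (qc ^ (listWeight u * b.degree) * qs ^ (a.degree * b.degree)) •
          consL K (a + b) (tw qc qs (Finsupp.single u 1) y) := by
  induction y using Finsupp.induction_linear with
  | zero => simp
  | add x y hx hy => simp only [map_add, hx, hy]; module
  | single v r =>
    rw [← mul_one r, ← smul_eq_mul, ← Finsupp.smul_single]
    simp only [map_smul, consL_single, tw_single, twisted_cons_cons]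
    module

/-- The power of `q_c` depends on the weight of the left word, so the recursion extends to a
combination of left words only if it is homogeneous. In `tw_cons_left` the left factor is a single
word and no such condition arises. -/
theorem tw_cons_right (qc qs : K) (a b : Mon) (m : ℕ) (v : List Mon) {x : List Mon →₀ K}
    (hx : x ∈ Finsupp.supported K K {w | listWeight w = m}) :
    tw qc qs (consL K a x) (Finsupp.single (b :: v) 1) =
      consL K a (tw qc qs x (Finsupp.single (b :: v) 1))
      + qc ^ ((a.degree + m) * b.degree) • consL K b (tw qc qs (consL K a x) (Finsupp.single v 1))
      + (qc ^ (m * b.degree) * qs ^ (a.degree * b.degree)) •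
          consL K (a + b) (tw qc qs x (Finsupp.single v 1)) := by
  have := eq_of_mem_supported (x := x)
    (f := (tw qc qs).flip (Finsupp.single (b :: v) 1) ∘ₗ consL K a)
    (g := consL K a ∘ₗ (tw qc qs).flip (Finsupp.single (b :: v) 1)
      + qc ^ ((a.degree + m) * b.degree) •
        consL K b ∘ₗ (tw qc qs).flip (Finsupp.single v 1) ∘ₗ consL K a
      + (qc ^ (m * b.degree) * qs ^ (a.degree * b.degree)) •
          consL K (a + b) ∘ₗ (tw qc qs).flip (Finsupp.single v 1)) ?_ hx
  · simpa using this
  · rintro u rfl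
    simp [twisted_cons_cons]

theorem twisted_homogeneous (qc qs : K) (u v : List Mon) :
    twisted qc qs u v ∈
      Finsupp.supported K K {w | listWeight w = listWeight u + listWeight v} :=
  Finsupp.supported_mono (fun _ h => QShuffle.listWeight_eq h) (twisted_mem_supported qc qs u v)

@[simp]
theorem tw_nil_left (qc qs : K) (x : List Mon →₀ K) :
    tw qc qs (Finsupp.single [] 1) x = x := by
  induction x using Finsupp.induction_linear with
  | zero => simp
  | add x y hx hy => simp [hx, hy]
  | single v r =>
    rw [← mul_one r, ← smul_eq_mul, ← Finsupp.smul_single, map_smul, tw_single, twisted_nil_left]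

@[simp]
theorem tw_nil_right (qc qs : K) (x : List Mon →₀ K) :
    tw qc qs x (Finsupp.single [] 1) = x := by
  induction x using Finsupp.induction_linear with
  | zero => simp
  | add x y hx hy => simp [hx, hy]
  | single v r =>
    rw [← mul_one r, ← smul_eq_mul, ← Finsupp.smul_single, map_smul, LinearMap.smul_apply,
      tw_single, twisted_nil_right]

/-- Both sides decompose according to the leading monomial, one of `a`, `b`, `c`, `a + b`, `a + c`,
`b + c`, `a + b + c`. The tails agree by induction, and the exponents agree because they are
biadditive in the weights. -/
theorem tw_twisted_assoc (qc qs : K) (u v w : List Mon) :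
    tw qc qs (twisted qc qs u v) (Finsupp.single w 1) =
      tw qc qs (Finsupp.single u 1) (twisted qc qs v w) := by
  induction u generalizing v w with
  | nil => simp [twisted_nil_left]
  | cons a u ihu =>
  induction v generalizing w with
  | nil => simp [twisted_nil_left, twisted_nil_right]
  | cons b v ihv =>
  induction w with
  | nil => simp [twisted_nil_right]
  | cons c w ihw =>
  have e1 := ihu (b :: v) (c :: w)
  have e2 := ihu (b :: v) w
  have e3 := ihv (c :: w)
  have e4 := ihv w
  have e5 := ihu v (c :: w)
  have e6 := ihu v w
  -- On the right-hand side the tails behind `a` come in three pieces that only together form `e1`;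
  -- on the left-hand side the same happens behind `c` with `ihw`. These two hypotheses must be
  -- expanded along with the goal.
  rw [twisted_cons_cons qc qs b c] at e1 ⊢
  rw [twisted_cons_cons qc qs a b] at ihw ⊢
  simp only [map_add, map_smul, LinearMap.add_apply, LinearMap.smul_apply] at e1 ihw ⊢
  rw [tw_cons_right qc qs a c _ w (twisted_homogeneous qc qs u (b :: v)),
    tw_cons_right qc qs b c _ w (twisted_homogeneous qc qs (a :: u) v),
    tw_cons_right qc qs (a + b) c _ w (twisted_homogeneous qc qs u v),
    tw_cons_left, tw_cons_left, tw_cons_left, e1, e2, e3, e4, e5, e6, ← ihw]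
  simp only [map_add, map_smul, listWeight_cons, add_assoc]
  module

theorem tw_assoc (qc qs : K) (x y z : List Mon →₀ K) :
    tw qc qs (tw qc qs x y) z = tw qc qs x (tw qc qs y z) := by
  induction x using Finsupp.induction_linear with
  | zero => simp
  | add x x' hx hy => simp [hx, hy]
  | single u r =>
  induction y using Finsupp.induction_linear with
  | zero => simp
  | add x x' hx hy => simp [hx, hy]
  | single v s =>
  induction z using Finsupp.induction_linear with
  | zero => simp
  | add x x' hx hy => simp [hx, hy]
  | single w t =>
  rw [← mul_one r, ← mul_one s, ← mul_one t]
  simp only [← smul_eq_mul, ← Finsupp.smul_single]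
  simp only [map_smul, LinearMap.smul_apply, tw_single, tw_twisted_assoc]

/-! ### Naturality -/

/-- Substitution of variables `x_i ↦ x_{f i}` in a list of monomials. -/
def relabel (f : ℕ → ℕ) (l : List Mon) : List Mon := l.map (Finsupp.mapDomain f)

@[simp] theorem relabel_nil (f : ℕ → ℕ) : relabel f [] = [] := rfl

@[simp] theorem relabel_cons (f : ℕ → ℕ) (a : Mon) (l : List Mon) :
    relabel f (a :: l) = Finsupp.mapDomain f a :: relabel f l := rfl

theorem translate_eq_relabel (n : ℕ) (l : List Mon) : translate n l = relabel (· + n) l := rfl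

theorem relabel_relabel (f g : ℕ → ℕ) (l : List Mon) :
    relabel f (relabel g l) = relabel (f ∘ g) l := by
  simp [relabel, Finsupp.mapDomain_comp]

@[simp]
theorem degree_mapDomain (f : ℕ → ℕ) (a : Mon) : (Finsupp.mapDomain f a).degree = a.degree := by
  induction a using Finsupp.induction_linear with
  | zero => simp
  | add x y hx hy => simp [Finsupp.mapDomain_add, hx, hy]
  | single v r => simp [Finsupp.mapDomain_single]

@[simp]
theorem listWeight_relabel (f : ℕ → ℕ) (l : List Mon) :
    listWeight (relabel f l) = listWeight l := by
  induction l with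
  | nil => simp
  | cons a l ih => simp [ih]

variable (K) in
/-- The linear extension of `relabel`. -/
def relabelL (f : ℕ → ℕ) : (List Mon →₀ K) →ₗ[K] (List Mon →₀ K) :=
  Finsupp.lmapDomain K K (relabel f)

@[simp]
theorem relabelL_single (f : ℕ → ℕ) (u : List Mon) (r : K) :
    relabelL K f (Finsupp.single u r) = Finsupp.single (relabel f u) r := by
  simp [relabelL]

theorem relabelL_consL (f : ℕ → ℕ) (a : Mon) (x : List Mon →₀ K) :
    relabelL K f (consL K a x) = consL K (Finsupp.mapDomain f a) (relabelL K f x) := by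
  simp only [relabelL, consL, Finsupp.lmapDomain_apply, ← Finsupp.mapDomain_comp]
  rfl

/-- The coefficients involve only degrees, which any substitution of variables preserves, injective
or not. -/
theorem relabelL_twisted (qc qs : K) (f : ℕ → ℕ) (u v : List Mon) :
    relabelL K f (twisted qc qs u v) = twisted qc qs (relabel f u) (relabel f v) := by
  induction u, v using twisted_induction with
  | nil_left w => simp [twisted_nil_left]
  | nil_right w => simp [twisted_nil_right]
  | cons a u b v h1 h2 h3 =>
    rw [twisted_cons_cons, relabel_cons, relabel_cons, twisted_cons_cons]
    simp only [map_add, map_smul, relabelL_consL, h1, h2, h3, relabel_cons, listWeight_cons,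
      degree_mapDomain, listWeight_relabel, Finsupp.mapDomain_add]

theorem relabelL_tw (qc qs : K) (f : ℕ → ℕ) (x y : List Mon →₀ K) :
    relabelL K f (tw qc qs x y) = tw qc qs (relabelL K f x) (relabelL K f y) := by
  induction x using Finsupp.induction_linear with
  | zero => simp
  | add x x' hx hy => simp [hx, hy]
  | single u r =>
  induction y using Finsupp.induction_linear with
  | zero => simp
  | add x x' hx hy => simp [hx, hy]
  | single v s =>
  rw [← mul_one r, ← mul_one s]
  simp only [← smul_eq_mul, ← Finsupp.smul_single]
  simp only [map_smul, LinearMap.smul_apply, tw_single, relabelL_twisted, relabelL_single]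

/-! ### Triangularity -/

/-- The highest index (counted from `1`) of a variable of a monomial. -/
def key (a : Mon) : ℕ := a.support.sup (· + 1)

theorem key_add (a b : Mon) : key (a + b) = max (key a) (key b) := by
  classical
  have : (a + b).support = a.support ∪ b.support := by ext; simp; omega
  rw [key, this, Finset.sup_union]; rfl

/-- The number of monomials of key at least `t` in a list. -/
def countKey (t : ℕ) (l : List Mon) : ℕ := l.countP fun a => t ≤ key a

/-- The number of pairs of positions `i ≤ j` of a list at which the keys are in weakly
increasing order. -/
def nonInv : List Mon → ℕ
  | [] => 0
  | a :: l => 1 + countKey (key a) l + nonInv l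

theorem QShuffle.length_le {u v w : List Mon} (h : QShuffle u v w) :
    w.length ≤ u.length + v.length := by
  induction h <;> simp at * <;> omega

theorem QShuffle.countKey_le {u v w : List Mon} (h : QShuffle u v w) (t : ℕ) :
    countKey t w ≤ countKey t u + countKey t v := by
  induction h with
  | nil_left | nil_right => simp [countKey]
  | left _ ih | right _ ih | both _ ih =>
    simp only [countKey, List.countP_cons, key_add, le_max_iff, decide_eq_true_eq] at ih ⊢
    split_ifs at * <;> omega

theorem countKey_eq_length {t : ℕ} {l : List Mon} (h : ∀ b ∈ l, t ≤ key b) :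
    countKey t l = l.length := by
  simpa [countKey] using h

theorem countKey_eq_zero {t : ℕ} {l : List Mon} (h : ∀ b ∈ l, key b < t) :
    countKey t l = 0 := by
  simpa [countKey] using h

theorem nonInv_append {n : ℕ} {u v : List Mon} (hu : ∀ a ∈ u, key a ≤ n)
    (hv : ∀ b ∈ v, n ≤ key b) :
    nonInv (u ++ v) = nonInv u + nonInv v + u.length * v.length := by
  induction u with
  | nil => simp [nonInv]
  | cons a u ih =>
    simp only [List.mem_cons, forall_eq_or_imp] at hu
    have := countKey_eq_length (t := key a) (l := v) fun b hb => hu.1.trans (hv b hb)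
    rw [List.cons_append, nonInv, nonInv, ih hu.2]
    simp only [countKey, List.countP_append, List.length_cons] at this ⊢
    rw [this]; ring

/-- In `u ++ v` every monomial of `u` precedes every monomial of `v` and has a smaller key, so all
cross pairs are counted. Moving a monomial of `v` ahead of one of `u` loses a cross pair. Merging
two monomials also loses pairs, since the result keeps only the key of the one from `v`. -/
theorem QShuffle.nonInv_lt {n : ℕ} {u v w : List Mon} (h : QShuffle u v w)
    (hu : ∀ a ∈ u, key a ≤ n) (hv : ∀ b ∈ v, n < key b) :
    w = u ++ v ∨ nonInv w < nonInv u + nonInv v + u.length * v.length := by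
  induction h with
  | nil_left | nil_right => simp
  | @left a u b v w h ih =>
    have hu' := hu
    simp only [List.mem_cons, forall_eq_or_imp] at hu'
    rcases ih hu'.2 hv with rfl | ih
    · simp
    · right
      have h1 := h.countKey_le (key a)
      have h2 := countKey_eq_length (t := key a) (l := b :: v)
        fun b hb => hu'.1.trans (hv b hb).le
      simp only [nonInv, List.length_cons, add_mul] at *
      omega
  | @right a u b v w h ih =>
    right
    have hv' := hv
    simp only [List.mem_cons, forall_eq_or_imp] at hv'
    have h1 := h.countKey_le (key b)
    have h2 := countKey_eq_zero (t := key b) (l := a :: u)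
      fun a ha => (hu a ha).trans_lt hv'.1
    have h3 : nonInv w ≤ nonInv (a :: u) + nonInv v + (a :: u).length * v.length := by
      rcases ih hu hv'.2 with rfl | ih
      · exact (nonInv_append hu fun b hb => (hv'.2 b hb).le).le
      · exact ih.le
    simp only [nonInv, List.length_cons, mul_add] at *
    omega
  | @both a u b v w h ih =>
    right
    have hv' := hv
    have hu' := hu
    simp only [List.mem_cons, forall_eq_or_imp] at hv' hu'
    have h0 : key (a + b) = key b := by rw [key_add, max_eq_right]; omega
    have h1 := h.countKey_le (key b)
    have h2 := countKey_eq_zero (t := key b) (l := u)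
      fun a ha => (hu'.2 a ha).trans_lt hv'.1
    have h3 : nonInv w ≤ nonInv u + nonInv v + u.length * v.length := by
      rcases ih hu'.2 hv'.2 with rfl | ih
      · exact (nonInv_append hu'.2 fun b hb => (hv'.2 b hb).le).le
      · exact ih.le
    simp only [nonInv, List.length_cons, mul_add, add_mul, h0] at *
    omega

/-- The twisted law is concatenation up to quasi-shuffles other than the concatenation. -/
theorem twisted_sub_mem_supported (qc qs : K) {n : ℕ} {u v : List Mon}
    (hu : ∀ a ∈ u, key a ≤ n) (hv : ∀ b ∈ v, n < key b) :
    twisted qc qs u v - Finsupp.single (u ++ v) 1 ∈ Finsupp.supported K K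
      {w | QShuffle u v w ∧ nonInv w < nonInv (u ++ v)} := by
  induction u, v using twisted_induction with
  | nil_left w => simp [twisted_nil_left]
  | nil_right w => simp [twisted_nil_right]
  | cons a u b v h1 h2 h3 =>
    have hu' := hu
    have hv' := hv
    simp only [List.mem_cons, forall_eq_or_imp] at hv' hu'
    -- Only the branch that takes `a` first can yield the concatenation, and its coefficient is `1`;
    -- the subtraction is pushed into that branch. The other two branches start with a monomial of
    -- key larger than `n`.
    have e : twisted qc qs (a :: u) (b :: v) - Finsupp.single (a :: u ++ b :: v) 1 =
        consL K a (twisted qc qs u (b :: v) - Finsupp.single (u ++ b :: v) 1)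
        + qc ^ (listWeight (a :: u) * b.degree) • consL K b (twisted qc qs (a :: u) v)
        + (qc ^ (listWeight u * b.degree) * qs ^ (a.degree * b.degree)) •
          consL K (a + b) (twisted qc qs u v) := by
      rw [twisted_cons_cons, map_sub, consL_single]
      simp only [List.cons_append]
      abel
    have hn := nonInv_append hu fun b hb => (hv b hb).le
    have hn' := nonInv_append hu'.2 fun b hb => (hv b hb).le
    have key1 : ∀ w, QShuffle (a :: u) (b :: v) w → w ≠ a :: u ++ b :: v →
        nonInv w < nonInv (a :: u ++ b :: v) := fun w hw hne => by
      rw [hn]; exact (hw.nonInv_lt hu hv).resolve_left hne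
    have hne : ∀ c, n < key c → ∀ w, c :: w ≠ a :: u ++ b :: v := fun c hc w hw => by
      rw [List.cons_append, List.cons.injEq] at hw
      have := hu'.1
      rw [hw.1] at hc
      omega
    rw [e]
    refine add_mem (add_mem (consL_mem_supported ?_ (h1 hu'.2 hv))
      (Submodule.smul_mem _ _ (consL_mem_supported ?_ (twisted_mem_supported qc qs _ _))))
      (Submodule.smul_mem _ _ (consL_mem_supported ?_ (twisted_mem_supported qc qs _ _)))
    · rintro w ⟨hw, hlt⟩
      refine ⟨hw.left, key1 _ hw.left ?_⟩
      rintro h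
      rw [List.cons_append, List.cons.injEq] at h
      rw [h.2] at hlt
      exact lt_irrefl _ hlt
    · intro w hw
      exact ⟨QShuffle.right hw, key1 _ (QShuffle.right hw) (hne _ hv'.1 _)⟩
    · intro w hw
      refine ⟨QShuffle.both hw, key1 _ (QShuffle.both hw) (hne _ ?_ _)⟩
      rw [key_add]
      exact lt_max_of_lt_right hv'.1

/-! ### Variables of a list of monomials, and packing -/

/-- The finite set of the variables that occur in a list of monomials. -/
def used (l : List Mon) : Finset ℕ := l.foldr (fun a s => a.support ∪ s) ∅

@[simp] theorem used_nil : used [] = ∅ := rfl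

@[simp] theorem used_cons (a : Mon) (l : List Mon) : used (a :: l) = a.support ∪ used l := rfl

theorem mem_used {k : ℕ} {l : List Mon} : k ∈ used l ↔ ∃ a ∈ l, a k ≠ 0 := by
  induction l with
  | nil => simp
  | cons a l ih => simp [ih]

theorem used_append (u v : List Mon) : used (u ++ v) = used u ∪ used v := by
  induction u with
  | nil => simp
  | cons a l ih => simp [ih, Finset.union_assoc]

theorem support_subset_used {a : Mon} {l : List Mon} (h : a ∈ l) : a.support ⊆ used l :=
  fun k hk => mem_used.2 ⟨a, h, by simpa using hk⟩

theorem used_mono {u v : List Mon} (h : u ⊆ v) : used u ⊆ used v := fun k hk => by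
  obtain ⟨a, ha, hk⟩ := mem_used.1 hk
  exact mem_used.2 ⟨a, h ha, hk⟩

theorem relabel_congr {f g : ℕ → ℕ} {l : List Mon} (h : ∀ k ∈ used l, f k = g k) :
    relabel f l = relabel g l :=
  List.map_congr_left fun _ ha =>
    Finsupp.mapDomain_congr fun k hk => h k (support_subset_used ha hk)

theorem relabel_id (l : List Mon) : relabel id l = l := by
  have : (Finsupp.mapDomain id : Mon → Mon) = id := funext fun _ => Finsupp.mapDomain_id
  rw [relabel, this, List.map_id]

theorem used_relabel {f : ℕ → ℕ} {l : List Mon} (h : Set.InjOn f (used l)) :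
    used (relabel f l) = (used l).image f := by
  induction l with
  | nil => simp
  | cons a l ih =>
    rw [used_cons, Finset.coe_union] at h
    rw [relabel_cons, used_cons, used_cons, ih (h.mono Set.subset_union_right),
      Finsupp.mapDomain_support_of_injOn _ (h.mono Set.subset_union_left), Finset.image_union]

theorem zero_notMem_relabel {f : ℕ → ℕ} {l : List Mon} (h : 0 ∉ l) : 0 ∉ relabel f l := by
  intro h0
  obtain ⟨a, ha, h0⟩ := List.mem_map.1 h0
  have : a.degree = 0 := by rw [← degree_mapDomain f a, h0, map_zero]
  rw [Finsupp.degree_eq_zero_iff] at this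
  exact h (this ▸ ha)

@[simp]
theorem length_relabel (f : ℕ → ℕ) (u : List Mon) : (relabel f u).length = u.length :=
  List.length_map _

theorem relabel_injective {f : ℕ → ℕ} (h : Function.Injective f) :
    Function.Injective (relabel f) :=
  List.map_injective_iff.2 (Finsupp.mapDomain_injective h)

theorem used_translate (n : ℕ) (l : List Mon) : used (translate n l) = (used l).image (· + n) :=
  used_relabel (add_left_injective n).injOn

theorem QShuffle.used_eq {u v w : List Mon} (h : QShuffle u v w) : used w = used u ∪ used v := by
  induction h with
  | nil_left | nil_right => simp
  | left _ ih | right _ ih =>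
    ext k; simp only [used_cons, ih, Finset.mem_union]; tauto
  | both _ ih =>
    ext k
    simp only [used_cons, ih, Finset.mem_union, Finsupp.mem_support_iff, Finsupp.add_apply, ne_eq,
      Nat.add_eq_zero_iff]
    tauto

theorem QShuffle.zero_notMem {u v w : List Mon} (h : QShuffle u v w) (hu : 0 ∉ u)
    (hv : 0 ∉ v) : 0 ∉ w := by
  induction h with
  | nil_left | nil_right => assumption
  | left _ ih | right _ ih | both _ ih =>
    simp only [List.mem_cons, not_or] at hu hv ih ⊢
    simp_all [eq_comm]

/-- The number of elements of `S` below `k`. -/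
def rankIn (S : Finset ℕ) (k : ℕ) : ℕ := (S.filter (· < k)).card

theorem rankIn_strictMonoOn (S : Finset ℕ) : StrictMonoOn (rankIn S) S := by
  intro a ha b _ hab
  refine Finset.card_lt_card (Finset.ssubset_iff_of_subset ?_ |>.2 ⟨a, ?_, ?_⟩)
  · intro k hk
    simp only [Finset.mem_filter] at hk ⊢
    exact ⟨hk.1, hk.2.trans hab⟩
  · simpa using ⟨ha, hab⟩
  · simp

theorem rankIn_range {n k : ℕ} (h : k < n) : rankIn (Finset.range n) k = k := by
  have : (Finset.range n).filter (· < k) = Finset.range k := by ext; simp; omega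
  rw [rankIn, this, Finset.card_range]

theorem rankIn_image {S : Finset ℕ} {f : ℕ → ℕ} (hf : StrictMonoOn f S) {k : ℕ} (hk : k ∈ S) :
    rankIn (S.image f) (f k) = rankIn S k := by
  have : (S.image f).filter (· < f k) = (S.filter (· < k)).image f := by
    rw [Finset.filter_image]
    congr 1
    exact Finset.filter_congr fun x hx => hf.lt_iff_lt hx hk
  rw [rankIn, this, Finset.card_image_of_injOn (hf.injOn.mono fun x hx =>
    (Finset.mem_filter.1 hx).1)]
  rfl

theorem image_rankIn (S : Finset ℕ) : S.image (rankIn S) = Finset.range S.card := by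
  refine Finset.eq_of_subset_of_card_le ?_ ?_
  · intro k hk
    obtain ⟨a, ha, rfl⟩ := Finset.mem_image.1 hk
    refine Finset.mem_range.2 (Finset.card_lt_card
      (Finset.ssubset_iff_of_subset (Finset.filter_subset _ _) |>.2 ⟨a, ha, by simp⟩))
  · rw [Finset.card_image_of_injOn (rankIn_strictMonoOn S).injOn, Finset.card_range]

/-- Renumbering of the variables of a list of monomials, in order, by an initial segment. -/
def std (l : List Mon) : List Mon := relabel (rankIn (used l)) l

theorem used_std (l : List Mon) : used (std l) = Finset.range (used l).card := by
  rw [std, used_relabel (rankIn_strictMonoOn _).injOn, image_rankIn]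

/-- An increasing renaming does not change the ranks of the variables; this makes packing
insensitive to earlier shifts and packings. -/
theorem std_relabel {f : ℕ → ℕ} {l : List Mon} (h : StrictMonoOn f (used l)) :
    std (relabel f l) = std l := by
  rw [std, used_relabel h.injOn, relabel_relabel, std]
  exact relabel_congr fun k hk => rankIn_image h hk

theorem std_of_used_eq_range {l : List Mon} {n : ℕ} (h : used l = Finset.range n) :
    std l = l := by
  conv_rhs => rw [← relabel_id l]
  refine relabel_congr fun k hk => ?_
  rw [h] at hk ⊢
  exact rankIn_range (Finset.mem_range.1 hk)

/-! ### Codes of diagrams -/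

@[simp]
theorem LDiag.length_code (d : LDiag) : d.code.length = d.p := by simp [LDiag.code]

theorem LDiag.used_code (d : LDiag) : used d.code = Finset.range d.q := by
  ext k
  simp only [mem_used, LDiag.code, List.mem_ofFn, exists_exists_eq_and, LDiag.code_apply,
    Finset.mem_range]
  constructor
  · rintro ⟨i, hi⟩
    by_contra hk
    simp [hk] at hi
  · intro hk
    obtain ⟨i, hi⟩ := d.col_ne ⟨k, hk⟩
    exact ⟨i, by simpa [hk] using hi⟩

theorem LDiag.zero_notMem_code (d : LDiag) : 0 ∉ d.code := by
  intro h
  obtain ⟨i, hi⟩ := List.mem_ofFn.1 h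
  obtain ⟨j, hj⟩ := d.row_ne i
  have := LDiag.code_apply d i j
  rw [hi] at this
  exact hj (by simpa using this.symm)

theorem LDiag.q_eq_card (d : LDiag) : d.q = (used d.code).card := by
  rw [d.used_code, Finset.card_range]

/-- Non-unit monomials give nonzero rows, and an initial segment of used variables gives nonzero
columns. -/
theorem exists_code_eq {l : List Mon} {n : ℕ} (h0 : 0 ∉ l) (h : used l = Finset.range n) :
    ∃ d : LDiag, d.code = l := by
  refine ⟨⟨l.length, n, fun i j => l.get i j, fun i => ?_, fun j => ?_⟩, ?_⟩
  · have hne : l.get i ≠ 0 := fun e => h0 (e ▸ List.get_mem l i)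
    obtain ⟨k, hk⟩ := Finsupp.ne_iff.1 hne
    have : k ∈ used l := mem_used.2 ⟨_, List.get_mem l i, by simpa using hk⟩
    rw [h, Finset.mem_range] at this
    exact ⟨⟨k, this⟩, by simpa using hk⟩
  · have : (j : ℕ) ∈ used l := by rw [h, Finset.mem_range]; exact j.2
    obtain ⟨a, ha, hk⟩ := mem_used.1 this
    obtain ⟨i, rfl⟩ := List.get_of_mem ha
    exact ⟨i, hk⟩
  · conv_rhs => rw [← List.ofFn_get l]
    rw [LDiag.code]
    congr 1
    funext i
    ext k
    rw [LDiag.code_apply]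
    split_ifs with hk
    · rfl
    · by_contra hne
      have : k ∈ used l := mem_used.2 ⟨_, List.get_mem l i, Ne.symm hne⟩
      rw [h, Finset.mem_range] at this
      exact hk this

theorem key_le_iff {a : Mon} {n : ℕ} : key a ≤ n ↔ a.support ⊆ Finset.range n := by
  simp only [key, Finset.sup_le_iff, Finset.subset_iff, Finset.mem_range, Nat.succ_le_iff]

theorem key_le_of_mem {l : List Mon} {n : ℕ} (h : used l ⊆ Finset.range n) :
    ∀ a ∈ l, key a ≤ n :=
  fun _ ha => key_le_iff.2 ((support_subset_used ha).trans h)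

theorem lt_key_of_mem_translate {l : List Mon} {n : ℕ} (h : 0 ∉ l) :
    ∀ b ∈ translate n l, n < key b := by
  intro b hb
  by_contra hlt
  have hb0 : b ≠ 0 := fun e => zero_notMem_relabel (f := (· + n)) h (e ▸ hb)
  obtain ⟨k, hk⟩ := Finsupp.support_nonempty_iff.2 hb0
  have h1 := Finset.mem_range.1 (key_le_iff.1 (not_lt.1 hlt) hk)
  have h2 := support_subset_used hb hk
  rw [used_translate] at h2
  simp only [Finset.mem_image] at h2
  omega

theorem maxIndex_eq (l : List Mon) : maxIndex l = (used l).sup (· + 1) := by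
  induction l with
  | nil => rfl
  | cons a l ih => rw [used_cons, Finset.sup_union, ← ih]; rfl

theorem LDiag.maxIndex_code (d : LDiag) : maxIndex d.code = d.q := by
  rw [maxIndex_eq, d.used_code]
  refine le_antisymm (Finset.sup_le fun k hk => Finset.mem_range.1 hk) ?_
  rcases hq : d.q with _ | n
  · simp
  · exact Finset.le_sup (f := (· + 1)) (Finset.self_mem_range_succ n)

/-- The diagram obtained from a list of non-unit monomials by deletion of the unused variables. -/
def packList (l : List Mon) : LDiag :=
  if h : 0 ∉ l then
    (exists_code_eq (zero_notMem_relabel (f := rankIn (used l)) h) (used_std l)).choose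
  else LDiag.empty

theorem code_packList {l : List Mon} (h : 0 ∉ l) : (packList l).code = std l := by
  rw [packList, dif_pos h]
  exact (exists_code_eq (zero_notMem_relabel (f := rankIn (used l)) h) (used_std l)).choose_spec

theorem p_packList {l : List Mon} (h : 0 ∉ l) : (packList l).p = l.length := by
  rw [← LDiag.length_code, code_packList h, std, length_relabel]

theorem q_packList {l : List Mon} (h : 0 ∉ l) : (packList l).q = (used l).card := by
  rw [LDiag.q_eq_card, code_packList h, used_std, Finset.card_range]

@[simp]
theorem packList_code (d : LDiag) : packList d.code = d :=
  LDiag.code_injective <| by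
    rw [code_packList d.zero_notMem_code, std_of_used_eq_range d.used_code]

theorem packList_relabel {f : ℕ → ℕ} {l : List Mon} (h0 : 0 ∉ l) (h : StrictMonoOn f (used l)) :
    packList (relabel f l) = packList l :=
  LDiag.code_injective <| by
    rw [code_packList (zero_notMem_relabel h0), code_packList h0, std_relabel h]

@[simp]
theorem LDiag.code_empty : LDiag.empty.code = [] := rfl

@[simp]
theorem packList_nil : packList [] = LDiag.empty := by
  rw [← LDiag.code_empty, packList_code]

theorem LDiag.code_eq_nil {d : LDiag} : d.code = [] ↔ d = LDiag.empty :=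
  ⟨fun h => LDiag.code_injective (by rw [h, LDiag.code_empty]), fun h => by rw [h, code_empty]⟩

theorem LDiag.p_eq_zero {d : LDiag} : d.p = 0 ↔ d = LDiag.empty := by
  rw [← LDiag.code_eq_nil, ← List.length_eq_zero_iff, LDiag.length_code]

/-! ### The deformed law on diagrams -/

variable (K) in
/-- The linear extension of `LDiag.code`. -/
def codeL : (LDiag →₀ K) →ₗ[K] (List Mon →₀ K) := Finsupp.lmapDomain K K LDiag.code

variable (K) in
/-- The linear extension of `packList`. -/
def packL : (List Mon →₀ K) →ₗ[K] (LDiag →₀ K) := Finsupp.lmapDomain K K packList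

@[simp]
theorem codeL_single (d : LDiag) (r : K) :
    codeL K (Finsupp.single d r) = Finsupp.single d.code r := by simp [codeL]

@[simp]
theorem packL_single (u : List Mon) (r : K) :
    packL K (Finsupp.single u r) = Finsupp.single (packList u) r := by simp [packL]

@[simp]
theorem packL_codeL (x : LDiag →₀ K) : packL K (codeL K x) = x := by
  simp only [packL, codeL, Finsupp.lmapDomain_apply, ← Finsupp.mapDomain_comp]
  convert Finsupp.mapDomain_id
  exact funext packList_code

theorem codeL_injective : Function.Injective (codeL K) :=
  Function.LeftInverse.injective packL_codeL

theorem shiftedTwisted_code (qc qs : K) (d e : LDiag) :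
    shiftedTwisted qc qs d.code e.code = twisted qc qs d.code (translate d.q e.code) := by
  rw [shiftedTwisted, LDiag.maxIndex_code]

theorem used_of_qShuffle_code {d e : LDiag} {w : List Mon}
    (h : QShuffle d.code (translate d.q e.code) w) : used w = Finset.range (d.q + e.q) := by
  rw [h.used_eq, used_translate, d.used_code, e.used_code]
  ext k
  simp only [Finset.mem_union, Finset.mem_range, Finset.mem_image]
  constructor
  · rintro (h | ⟨i, hi, rfl⟩) <;> omega
  · intro h
    by_cases hk : k < d.q
    · exact .inl hk
    · exact .inr ⟨k - d.q, by omega, by omega⟩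

theorem zero_notMem_of_qShuffle_code {d e : LDiag} {n : ℕ} {w : List Mon}
    (h : QShuffle d.code (translate n e.code) w) : 0 ∉ w :=
  h.zero_notMem d.zero_notMem_code (zero_notMem_relabel e.zero_notMem_code)

theorem exists_code_of_qShuffle {d e : LDiag} {w : List Mon}
    (h : QShuffle d.code (translate d.q e.code) w) : ∃ f : LDiag, f.code = w :=
  exists_code_eq (zero_notMem_of_qShuffle_code h) (used_of_qShuffle_code h)

theorem bilin_single (f : LDiag → LDiag → (LDiag →₀ K)) (d e : LDiag) :
    bilin f (Finsupp.single d 1) (Finsupp.single e 1) = f d e := by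
  simp [bilin]

/-- Quasi-shuffles of a code with a shifted code consist of non-unit monomials and use an initial
segment of the variables, so they are codes. Pulling back along `LDiag.code` therefore discards no
term. -/
theorem mapDomain_code_deformedMul (qc qs : K) (d e : LDiag) :
    Finsupp.mapDomain LDiag.code
        (deformedMul qc qs (Finsupp.single d 1) (Finsupp.single e 1)) =
      shiftedTwisted qc qs d.code e.code := by
  rw [deformedMul, bilin_single]
  refine Finsupp.mapDomain_comapDomain _ LDiag.code_injective _ ?_
  rw [shiftedTwisted_code]
  exact fun w hw => exists_code_of_qShuffle (twisted_mem_supported qc qs _ _ hw)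

theorem codeL_deformedMul_single (qc qs : K) (d e : LDiag) :
    codeL K (deformedMul qc qs (Finsupp.single d 1) (Finsupp.single e 1)) =
      twisted qc qs d.code (translate d.q e.code) := by
  rw [← shiftedTwisted_code, ← mapDomain_code_deformedMul]
  rfl

theorem deformedMul_single (qc qs : K) (d e : LDiag) :
    deformedMul qc qs (Finsupp.single d 1) (Finsupp.single e 1) =
      packL K (twisted qc qs d.code (translate d.q e.code)) := by
  rw [← codeL_deformedMul_single, packL_codeL]

theorem deformedMul_single_mem_supported (qc qs : K) (d e : LDiag) :
    deformedMul qc qs (Finsupp.single d 1) (Finsupp.single e 1) ∈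
      Finsupp.supported K K {f | QShuffle d.code (translate d.q e.code) f.code} := by
  rw [Finsupp.mem_supported]
  intro f hf
  have h1 := twisted_mem_supported qc qs d.code (translate d.q e.code)
  rw [← codeL_deformedMul_single, Finsupp.mem_supported] at h1
  refine h1 ?_
  rw [codeL, Finsupp.lmapDomain_apply, Finset.mem_coe, Finsupp.mem_support_iff,
    Finsupp.mapDomain_apply LDiag.code_injective]
  simpa using hf

/-- A bilinear identity holds as soon as it holds on basis vectors. -/
theorem bilin_ext {ι κ M : Type*} [AddCommMonoid M] [Module K M]
    {f g : (ι →₀ K) →ₗ[K] (κ →₀ K) →ₗ[K] M}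
    (h : ∀ i j, f (Finsupp.single i 1) (Finsupp.single j 1) =
      g (Finsupp.single i 1) (Finsupp.single j 1)) : f = g := by
  ext i j
  exact h i j

/-- The shift depends on the number of white spots of the left factor; it is a single linear
operation only when this number is constant on `x`. -/
theorem codeL_deformedMul_of_supported (qc qs : K) {n : ℕ} {x y : LDiag →₀ K}
    (hx : x ∈ Finsupp.supported K K {d | d.q = n}) :
    codeL K (deformedMul qc qs x y) = tw qc qs (codeL K x) (relabelL K (· + n) (codeL K y)) := by
  induction y using Finsupp.induction_linear with
  | zero => simp
  | add y y' h h' => simp only [map_add, h, h']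
  | single e r =>
    rw [← mul_one r, ← smul_eq_mul, ← Finsupp.smul_single]
    simp only [map_smul]
    congr 1
    refine eq_of_mem_supported
      (f := codeL K ∘ₗ (deformedMul qc qs).flip (Finsupp.single e 1))
      (g := (tw qc qs).flip (relabelL K (· + n) (codeL K (Finsupp.single e 1))) ∘ₗ codeL K) ?_ hx
    rintro d rfl
    simp only [LinearMap.comp_apply, LinearMap.flip_apply, codeL_deformedMul_single, codeL_single,
      relabelL_single, tw_single]
    rfl

theorem QShuffle.q_eq {d e f : LDiag} (h : QShuffle d.code (translate d.q e.code) f.code) :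
    f.q = d.q + e.q := by
  rw [f.q_eq_card, used_of_qShuffle_code h, Finset.card_range]

/-- All terms of the product of `d` and `e` have `d.q + e.q` white spots, so the third code is
shifted by this amount in both bracketings. The rest is associativity and naturality of the
unshifted law. -/
theorem deformedMul_assoc (qc qs : K) (x y z : LDiag →₀ K) :
    deformedMul qc qs (deformedMul qc qs x y) z = deformedMul qc qs x (deformedMul qc qs y z) := by
  induction x using Finsupp.induction_linear with
  | zero => simp
  | add x x' hx hy => simp [hx, hy]
  | single d r =>
  induction y using Finsupp.induction_linear with
  | zero => simp
  | add x x' hx hy => simp [hx, hy]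
  | single e s =>
  rw [← mul_one r, ← mul_one s]
  simp only [← smul_eq_mul, ← Finsupp.smul_single]
  simp only [map_smul, LinearMap.smul_apply]
  congr 2
  have hm : ∀ d : LDiag, Finsupp.single d (1 : K) ∈ Finsupp.supported K K {e | e.q = d.q} :=
    fun d => Finsupp.single_mem_supported _ _ rfl
  have hde : deformedMul qc qs (Finsupp.single d 1) (Finsupp.single e 1) ∈
      Finsupp.supported K K {f | f.q = d.q + e.q} :=
    Finsupp.supported_mono (fun f hf => QShuffle.q_eq hf)
      (deformedMul_single_mem_supported qc qs d e)
  apply codeL_injective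
  rw [codeL_deformedMul_of_supported qc qs hde, codeL_deformedMul_of_supported qc qs (hm d),
    codeL_deformedMul_of_supported qc qs (hm d), codeL_deformedMul_of_supported qc qs (hm e),
    relabelL_tw, tw_assoc]
  congr 2
  simp only [relabelL, Finsupp.lmapDomain_apply, ← Finsupp.mapDomain_comp]
  congr 1
  funext l
  simp only [Function.comp_apply, relabel_relabel]
  congr 1
  funext k
  simp only [Function.comp_apply]
  omega

theorem deformedMul_one_left (qc qs : K) (x : LDiag →₀ K) :
    deformedMul qc qs (Finsupp.single LDiag.empty 1) x = x := by
  apply codeL_injective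
  have h : Finsupp.single LDiag.empty (1 : K) ∈ Finsupp.supported K K {e | e.q = 0} :=
    Finsupp.single_mem_supported _ _ rfl
  rw [codeL_deformedMul_of_supported qc qs h, codeL_single, LDiag.code_empty, tw_nil_left,
    relabelL, Finsupp.lmapDomain_apply]
  convert Finsupp.mapDomain_id
  exact funext relabel_id

theorem deformedMul_one_right (qc qs : K) (x : LDiag →₀ K) :
    deformedMul qc qs x (Finsupp.single LDiag.empty 1) = x := by
  induction x using Finsupp.induction_linear with
  | zero => simp
  | add x x' hx hy => simp [hx, hy]
  | single d r =>
    rw [← mul_one r, ← smul_eq_mul, ← Finsupp.smul_single, map_smul, LinearMap.smul_apply,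
      deformedMul_single, LDiag.code_empty]
    simp [translate, twisted_nil_right]

/-- The deformed product of packed lists is the packing of a shifted product. -/
theorem deformedMul_packList (qc qs : K) {u v : List Mon} {n : ℕ} (hu : 0 ∉ u) (hv : 0 ∉ v)
    (hn : used u ⊆ Finset.range n) :
    deformedMul qc qs (Finsupp.single (packList u) 1) (Finsupp.single (packList v) 1) =
      packL K (twisted qc qs u (translate n v)) := by
  have hv' : 0 ∉ translate n v := zero_notMem_relabel hv
  -- Ranking in `S` performs both packings at once: the variables of `u` lie below `n` and keep
  -- their rank in `used u`, and the shifted variables of `v` come after all of them.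
  set S := used u ∪ used (translate n v) with hS
  have hSm : ∀ k, k ∈ S ↔ k ∈ used u ∨ ∃ i ∈ used v, i + n = k := by
    simp [hS, used_translate]
  have e1 : relabel (rankIn S) u = std u := relabel_congr fun k hk => by
    unfold rankIn
    congr 1
    ext i
    have := Finset.mem_range.1 (hn hk)
    simp only [Finset.mem_filter, hSm]
    constructor
    · rintro ⟨h | ⟨j, -, rfl⟩, h'⟩
      · exact ⟨h, h'⟩
      · omega
    · rintro ⟨h, h'⟩
      exact ⟨.inl h, h'⟩
  have e2 : relabel (rankIn S) (translate n v) = translate (used u).card (std v) := by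
    rw [translate_eq_relabel, translate_eq_relabel, std, relabel_relabel, relabel_relabel]
    refine relabel_congr fun k hk => ?_
    have : S.filter (· < k + n) = used u ∪ ((used v).filter (· < k)).image (· + n) := by
      ext i
      simp only [Finset.mem_filter, Finset.mem_union, Finset.mem_image, hSm]
      constructor
      · rintro ⟨h | ⟨j, hj, rfl⟩, h'⟩
        · exact .inl h
        · exact .inr ⟨j, ⟨hj, by omega⟩, rfl⟩
      · rintro (h | ⟨j, ⟨hj, h'⟩, rfl⟩)
        · have := Finset.mem_range.1 (hn h)
          exact ⟨.inl h, by omega⟩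
        · exact ⟨.inr ⟨j, hj, rfl⟩, by omega⟩
    simp only [Function.comp_apply]
    rw [rankIn, this, Finset.card_union_of_disjoint, Finset.card_image_of_injective _
      (add_left_injective n), add_comm]
    · rfl
    · rw [Finset.disjoint_left]
      intro i hi hi'
      have := Finset.mem_range.1 (hn hi)
      obtain ⟨j, -, rfl⟩ := Finset.mem_image.1 hi'
      omega
  rw [deformedMul_single, code_packList hu, code_packList hv, q_packList hu, ← e1, ← e2,
    ← relabelL_twisted]
  refine eq_of_mem_supported (f := packL K ∘ₗ relabelL K (rankIn S)) (g := packL K) ?_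
    (twisted_mem_supported qc qs u (translate n v))
  intro w hw
  simp only [LinearMap.comp_apply, relabelL_single, packL_single]
  rw [packList_relabel (hw.zero_notMem hu hv')]
  rw [hw.used_eq]
  exact rankIn_strictMonoOn S

/-! ### The free monoid of diagrams -/

theorem LDiag.code_concat (d e : LDiag) :
    (d.concat e).code = d.code ++ translate d.q e.code := by
  let m : Fin (d.p + e.p) → Fin (d.q + e.q) → ℕ :=
    Fin.addCases (fun i => Fin.addCases (fun j => d.m i j) (fun _ => 0))
      (fun i => Fin.addCases (fun _ => 0) (fun j => e.m i j))
  have h : (d.concat e).code =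
      List.ofFn fun i => ∑ j : Fin (d.q + e.q), Finsupp.single (j : ℕ) (m i j) := rfl
  rw [h, List.ofFn_add, translate, LDiag.code, LDiag.code, List.map_ofFn]
  congr 2
  · funext i
    rw [Fin.sum_univ_add]
    have : Fin.castLE (Nat.le_add_right d.p e.p) i = Fin.castAdd e.p i := rfl
    simp [m, this]
  · funext i
    rw [Fin.sum_univ_add]
    simp [m, Finsupp.mapDomain_finsetSum, Finsupp.mapDomain_single, add_comm]

theorem translate_append (n : ℕ) (u v : List Mon) :
    translate n (u ++ v) = translate n u ++ translate n v := List.map_append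

theorem translate_translate (m n : ℕ) (u : List Mon) :
    translate m (translate n u) = translate (n + m) u := by
  simp only [translate_eq_relabel, relabel_relabel]
  congr 1
  funext k
  simp only [Function.comp_apply]
  omega

theorem translate_zero (u : List Mon) : translate 0 u = u := relabel_id u

theorem translate_injective (n : ℕ) : Function.Injective (translate n) :=
  relabel_injective (add_left_injective n)

theorem LDiag.concat_assoc (c d e : LDiag) :
    (c.concat d).concat e = c.concat (d.concat e) :=
  LDiag.code_injective <| by
    simp only [LDiag.code_concat, translate_append, translate_translate, List.append_assoc]
    rw [add_comm]
    rfl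

@[simp]
theorem LDiag.empty_concat (d : LDiag) : LDiag.empty.concat d = d :=
  LDiag.code_injective <| by
    rw [LDiag.code_concat, LDiag.code_empty]; exact translate_zero _

@[simp]
theorem LDiag.concat_empty (d : LDiag) : d.concat LDiag.empty = d :=
  LDiag.code_injective <| by
    rw [LDiag.code_concat, LDiag.code_empty]; exact List.append_nil _

/-- Equidivisibility of the monoid of diagrams. -/
theorem LDiag.exists_of_concat_eq {y z y' z' : LDiag} (h : y.concat z = y'.concat z')
    (hp : y.p ≤ y'.p) : ∃ t : LDiag, y' = y.concat t ∧ z = t.concat z' := by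
  have hc : y.code ++ translate y.q z.code = y'.code ++ translate y'.q z'.code := by
    rw [← LDiag.code_concat, ← LDiag.code_concat, h]
  obtain ⟨l, hl, hl'⟩ : ∃ l, y'.code = y.code ++ l ∧
      translate y.q z.code = l ++ translate y'.q z'.code := by
    rcases List.append_eq_append_iff.1 hc with h | ⟨l, hl, hl'⟩
    · exact h
    · have : l.length = 0 := by
        have := congrArg List.length hl
        simp at this; omega
      rw [List.length_eq_zero_iff] at this
      subst this
      exact ⟨[], by simpa using hl.symm, by simpa using hl'.symm⟩
  -- The overlap `l` begins a shifted list, so it is itself the shift of a list `s`, which will be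
  -- the code of `t`.
  obtain ⟨s, s', hs, rfl, hs'⟩ := List.map_eq_append_iff.1 hl'
  change translate y.q s' = _ at hs'
  change _ = y.code ++ translate y.q s at hl
  have hq : y.q ≤ y'.q := by
    have := used_append y.code (translate y.q s)
    rw [← hl, y'.used_code, y.used_code] at this
    rw [← Finset.range_subset_range, this]
    exact Finset.subset_union_left
  have h0 : 0 ∉ s := fun hm => z.zero_notMem_code (by rw [hs]; exact List.mem_append_left _ hm)
  -- The variables of `y'` from `y.q` on can only come from the shifted `s`.
  have hu : used s = Finset.range (y'.q - y.q) := by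
    have hu := used_append y.code (translate y.q s)
    rw [← hl, y'.used_code, y.used_code, used_translate] at hu
    ext k
    have := congrArg (fun S => k + y.q ∈ S) hu
    simp only [Finset.mem_range, Finset.mem_union, Finset.mem_image, add_left_inj,
      exists_eq_right, eq_iff_iff] at this
    have h2 : ¬ k + y.q < y.q := by omega
    rw [Finset.mem_range]
    constructor
    · intro h
      have := this.2 (.inr h)
      omega
    · intro h
      exact (this.1 (by omega)).resolve_left h2
  obtain ⟨t, rfl⟩ := exists_code_eq h0 hu
  have htq : t.q = y'.q - y.q := by rw [t.q_eq_card, hu, Finset.card_range]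
  refine ⟨t, LDiag.code_injective ?_, LDiag.code_injective ?_⟩
  · rw [LDiag.code_concat, hl]
  · rw [LDiag.code_concat, hs]
    congr 1
    apply translate_injective y.q
    rw [hs', translate_translate, htq, Nat.sub_add_cancel hq]

/-- The concatenation of a word of irreducible diagrams. -/
def concWord (w : List Irr) : LDiag := w.foldr (fun d x => d.1.concat x) LDiag.empty

@[simp] theorem concWord_nil : concWord [] = LDiag.empty := rfl

@[simp] theorem concWord_cons (d : Irr) (w : List Irr) :
    concWord (d :: w) = d.1.concat (concWord w) := rfl

theorem concWord_append (v w : List Irr) :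
    concWord (v ++ w) = (concWord v).concat (concWord w) := by
  induction v with
  | nil => simp
  | cons d v ih => rw [List.cons_append, concWord_cons, ih, concWord_cons, LDiag.concat_assoc]

theorem LDiag.concat_eq_empty {d e : LDiag} (h : d.concat e = LDiag.empty) :
    d = LDiag.empty ∧ e = LDiag.empty := by
  have : d.p + e.p = 0 := congrArg LDiag.p h
  exact ⟨LDiag.p_eq_zero.1 (by omega), LDiag.p_eq_zero.1 (by omega)⟩

theorem concWord_surjective : Function.Surjective concWord := by
  intro d
  induction hn : d.p using Nat.strong_induction_on generalizing d with
  | _ n ih =>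
  subst hn
  by_cases h0 : d = LDiag.empty
  · exact ⟨[], h0.symm⟩
  by_cases hd : d.IsIrreducible
  · exact ⟨[⟨d, hd⟩], LDiag.concat_empty d⟩
  · simp only [LDiag.IsIrreducible, not_and, not_forall, not_or] at hd
    obtain ⟨y, z, rfl, hy, hz⟩ := hd h0
    have hp : (y.concat z).p = y.p + z.p := rfl
    have hy' := mt LDiag.p_eq_zero.1 hy
    have hz' := mt LDiag.p_eq_zero.1 hz
    obtain ⟨v, rfl⟩ := ih y.p (by omega) y rfl
    obtain ⟨w, rfl⟩ := ih z.p (by omega) z rfl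
    exact ⟨v ++ w, concWord_append v w⟩

/-- By equidivisibility one of the first factors is a left factor of the other, and irreducibility
forces the quotient to be empty. -/
theorem Irr.eq_and_eq_of_concat_eq {d e : Irr} {x y : LDiag} (h : d.1.concat x = e.1.concat y) :
    d = e ∧ x = y := by
  wlog hp : d.1.p ≤ e.1.p generalizing d e x y
  · exact (this h.symm (by omega)).imp Eq.symm Eq.symm
  obtain ⟨t, h1, rfl⟩ := LDiag.exists_of_concat_eq h hp
  rcases e.2.2 _ _ h1 with h2 | rfl
  · exact absurd h2 d.2.1
  · exact ⟨Subtype.ext (by simpa using h1.symm), by simp⟩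

theorem concWord_injective : Function.Injective concWord := by
  intro v
  induction v with
  | nil =>
    rintro (_ | ⟨d, w⟩) h
    · rfl
    · exact absurd (LDiag.concat_eq_empty h.symm).1 d.2.1
  | cons d v ih =>
    rintro (_ | ⟨e, w⟩) h
    · exact absurd (LDiag.concat_eq_empty h).1 d.2.1
    · obtain ⟨rfl, h2⟩ := Irr.eq_and_eq_of_concat_eq h
      rw [ih h2]

/-! ### The irreducible diagrams are free generators -/

theorem map_mem_of_supported {ι M : Type*} [AddCommGroup M] [Module K M] {s : Set ι}
    {f : (ι →₀ K) →ₗ[K] M} {N : Submodule K M} (h : ∀ i ∈ s, f (Finsupp.single i 1) ∈ N)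
    {x : ι →₀ K} (hx : x ∈ Finsupp.supported K K s) : f x ∈ N := by
  rw [Finsupp.supported_eq_span_single] at hx
  have : Submodule.span K ((fun i => Finsupp.single i (1 : K)) '' s) ≤ N.comap f :=
    Submodule.span_le.2 (by rintro _ ⟨i, hi, rfl⟩; exact h i hi)
  exact this hx

theorem mem_supported_of_codeL {s : Set (List Mon)} {x : LDiag →₀ K}
    (h : codeL K x ∈ Finsupp.supported K K s) :
    x ∈ Finsupp.supported K K (LDiag.code ⁻¹' s) := by
  rw [Finsupp.mem_supported] at h ⊢
  intro d hd
  refine h ?_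
  rw [codeL, Finsupp.lmapDomain_apply, Finset.mem_coe, Finsupp.mem_support_iff,
    Finsupp.mapDomain_apply LDiag.code_injective]
  simpa using hd

/-- A linear endomorphism of a free module that is unitriangular with respect to a rank function
on the basis is bijective. -/
theorem bijective_of_unitriangular {ι : Type*} (rk : ι → ℕ) (f : (ι →₀ K) →ₗ[K] (ι →₀ K))
    (hf : ∀ i, f (Finsupp.single i 1) - Finsupp.single i 1 ∈
      Finsupp.supported K K {j | rk j < rk i}) : Function.Bijective f := by
  constructor
  · rw [injective_iff_map_eq_zero]
    intro x hx
    -- When `f x = 0`, the vector `-x` equals `(f - id) x`, whose ranks are strictly below any bound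
    -- valid for `x`; the bound descends to zero.
    have step : ∀ n, x ∈ Finsupp.supported K K {j | rk j < n} → x = 0 := by
      intro n
      induction n with
      | zero => intro h; simpa using h
      | succ n ih =>
        intro h
        refine ih ?_
        have := map_mem_of_supported (f := f - LinearMap.id)
          (N := Finsupp.supported K K {j | rk j < n}) (fun i hi => ?_) h
        · simpa [hx] using this
        · refine Finsupp.supported_mono (fun j hj => ?_) (hf i)
          simp only [Set.mem_ofPred_eq] at hi hj ⊢
          omega
    refine step (x.support.sup rk + 1) ?_
    rw [Finsupp.mem_supported]
    intro i hi
    exact Nat.lt_succ_of_le (Finset.le_sup hi)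
  · rw [← LinearMap.range_eq_top, eq_top_iff]
    -- A basis vector differs from its image by vectors of smaller rank, which are already in the
    -- range.
    have step : ∀ n, ∀ i, rk i < n → Finsupp.single i (1 : K) ∈ LinearMap.range f := by
      intro n
      induction n with
      | zero => intro i hi; omega
      | succ n ih =>
        intro i hi
        have := map_mem_of_supported (f := LinearMap.id) (N := LinearMap.range f)
          (fun j hj => ih j ?_) (hf i)
        · have h2 := sub_mem (LinearMap.mem_range_self f (Finsupp.single i 1)) this
          simpa using h2
        · simp only [Set.mem_ofPred_eq] at hj
          omega
    intro x _
    have := map_mem_of_supported (f := LinearMap.id) (N := LinearMap.range f) (s := Set.univ)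
      (fun i _ => step (rk i + 1) i (Nat.lt_succ_self _)) (x := x) (by simp)
    exact this

theorem deformedMul_sub_mem_supported (qc qs : K) (d e : LDiag) :
    deformedMul qc qs (Finsupp.single d 1) (Finsupp.single e 1) -
        Finsupp.single (d.concat e) 1 ∈
      Finsupp.supported K K {f | f.p ≤ (d.concat e).p ∧
        nonInv f.code < nonInv (d.concat e).code} := by
  have := twisted_sub_mem_supported qc qs (n := d.q) (u := d.code) (v := translate d.q e.code)
    (key_le_of_mem d.used_code.subset) (lt_key_of_mem_translate e.zero_notMem_code)
  rw [← codeL_deformedMul_single, ← LDiag.code_concat, ← codeL_single, ← map_sub] at this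
  refine Finsupp.supported_mono ?_ (mem_supported_of_codeL this)
  rintro f ⟨h1, h2⟩
  have := h1.length_le
  simp only [LDiag.length_code, translate_eq_relabel, length_relabel] at this
  exact ⟨this, h2⟩

theorem nonInv_code_concat (d e : LDiag) : nonInv (d.concat e).code =
    nonInv d.code + nonInv (translate d.q e.code) + d.p * e.p := by
  rw [LDiag.code_concat, nonInv_append (n := d.q) (key_le_of_mem d.used_code.subset)
    fun b hb => (lt_key_of_mem_translate e.zero_notMem_code b hb).le]
  simp [translate_eq_relabel]

/-- A shift by `n` adds `n` to the key of every monomial except the unit, whose key stays `0`. -/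
theorem key_mapDomain_le_iff {n : ℕ} {a b : Mon} (ha : a ≠ 0) (hb : b ≠ 0) :
    key (Finsupp.mapDomain (· + n) a) ≤ key (Finsupp.mapDomain (· + n) b) ↔ key a ≤ key b := by
  have h : ∀ a : Mon, a ≠ 0 → key (Finsupp.mapDomain (· + n) a) = key a + n := by
    intro a ha
    rw [key, Finsupp.mapDomain_support_of_injOn _ (add_left_injective n).injOn, Finset.sup_image,
      key]
    have hne := Finsupp.support_nonempty_iff.2 ha
    rw [← Finset.sup'_eq_sup hne, ← Finset.sup'_eq_sup hne]
    refine le_antisymm (Finset.sup'_le _ _ fun k hk => ?_) ?_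
    · have := Finset.le_sup' (· + 1) hk
      simp only [Function.comp_apply] at this ⊢
      omega
    · obtain ⟨k, hk, e⟩ := Finset.exists_mem_eq_sup' hne (· + 1)
      rw [e]
      refine le_trans ?_ (Finset.le_sup' _ hk)
      simp only [Function.comp_apply]
      omega
  rw [h a ha, h b hb]
  omega

theorem nonInv_translate (n : ℕ) {l : List Mon} (h : 0 ∉ l) :
    nonInv (translate n l) = nonInv l := by
  induction l with
  | nil => rfl
  | cons a l ih =>
    simp only [List.mem_cons, not_or] at h
    rw [translate_eq_relabel, relabel_cons, nonInv, nonInv, ← translate_eq_relabel, ih h.2]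
    congr 2
    rw [countKey, countKey, translate, List.countP_map]
    refine List.countP_congr fun b hb => ?_
    simp only [Function.comp_apply, decide_eq_true_eq]
    exact key_mapDomain_le_iff (Ne.symm h.1) (fun e => h.2 (e ▸ hb))

theorem wordProd_single (A : HopfOps K) (w : List Irr) :
    A.wordProd (Finsupp.single w 1) =
      w.foldr (fun d x => A.mul (Finsupp.single d.1 1) x) A.one := by
  simp [HopfOps.wordProd]

theorem wordProd_cons (A : HopfOps K) (d : Irr) (w : List Irr) :
    A.wordProd (Finsupp.single (d :: w) 1) =
      A.mul (Finsupp.single d.1 1) (A.wordProd (Finsupp.single w 1)) := by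
  simp [wordProd_single]

/-- Error terms of the shorter word must remain errors after multiplication by `d` on the left.
Since `nonInv` of a concatenation contains the cross term `d.p * f.p`, the induction has to carry a
bound on the number of black spots as well. -/
theorem wordProd_sub_mem_supported {A : HopfOps K} {qc qs : K} (hm : A.mul = deformedMul qc qs)
    (h1 : A.one = Finsupp.single LDiag.empty 1) (w : List Irr) :
    A.wordProd (Finsupp.single w 1) - Finsupp.single (concWord w) 1 ∈
      Finsupp.supported K K {f | f.p ≤ (concWord w).p ∧
        nonInv f.code < nonInv (concWord w).code} := by
  induction w with
  | nil => simp [wordProd_single, h1]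
  | cons d w ih =>
    have e : A.wordProd (Finsupp.single (d :: w) 1) - Finsupp.single (concWord (d :: w)) 1 =
        A.mul (Finsupp.single d.1 1)
          (A.wordProd (Finsupp.single w 1) - Finsupp.single (concWord w) 1) +
        (deformedMul qc qs (Finsupp.single d.1 1) (Finsupp.single (concWord w) 1) -
          Finsupp.single (d.1.concat (concWord w)) 1) := by
      rw [wordProd_cons, map_sub, hm, concWord_cons]; abel
    rw [e]
    refine add_mem (map_mem_of_supported (fun f hf => ?_) ih)
      (deformedMul_sub_mem_supported qc qs _ _)
    rw [hm]
    refine Finsupp.supported_mono ?_ (deformedMul_single_mem_supported qc qs d.1 f)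
    intro g hg
    have hl := hg.length_le
    have hn := hg.nonInv_lt (n := d.1.q) (key_le_of_mem d.1.used_code.subset)
      (lt_key_of_mem_translate f.zero_notMem_code)
    simp only [LDiag.length_code, translate_eq_relabel, length_relabel] at hl hn
    have hc := nonInv_code_concat d.1 (concWord w)
    have hc' := nonInv_code_concat d.1 f
    rw [LDiag.code_concat d.1 f, nonInv_translate _ f.zero_notMem_code] at hc'
    rw [nonInv_translate _ (concWord w).zero_notMem_code] at hc
    have hmul := Nat.mul_le_mul_left d.1.p hf.1
    rw [← translate_eq_relabel, nonInv_translate _ f.zero_notMem_code] at hn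
    have hp : (concWord (d :: w)).p = d.1.p + (concWord w).p := rfl
    have h1 := hf.1
    have h2 := hf.2
    refine ⟨by omega, ?_⟩
    rw [concWord_cons, hc]
    rcases hn with hn | hn
    · rw [hn, hc']; omega
    · omega

/-- Once words are identified with diagrams by unique factorization, the map is unitriangular for
`nonInv`. This is the freeness of the deformed algebra. -/
theorem wordProd_bijective {A : HopfOps K} {qc qs : K} (hm : A.mul = deformedMul qc qs)
    (h1 : A.one = Finsupp.single LDiag.empty 1) : Function.Bijective A.wordProd := by
  let σ : List Irr ≃ LDiag := Equiv.ofBijective concWord ⟨concWord_injective, concWord_surjective⟩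
  let F : (LDiag →₀ K) →ₗ[K] (LDiag →₀ K) :=
    A.wordProd ∘ₗ (Finsupp.domLCongr σ.symm : (LDiag →₀ K) ≃ₗ[K] (List Irr →₀ K)).toLinearMap
  have hF : Function.Bijective F := by
    refine bijective_of_unitriangular (fun d => nonInv d.code) F fun d => ?_
    obtain ⟨w, rfl⟩ := concWord_surjective d
    have : σ.symm (concWord w) = w := σ.symm_apply_apply w
    simp only [F, LinearMap.comp_apply, LinearEquiv.coe_coe, Finsupp.domLCongr_single, this]
    exact Finsupp.supported_mono (fun f hf => hf.2) (wordProd_sub_mem_supported hm h1 w)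
  exact (Function.Bijective.of_comp_iff A.wordProd
    (Finsupp.domLCongr σ.symm : (LDiag →₀ K) ≃ₗ[K] (List Irr →₀ K)).bijective).1 hF

/-! ### The antipode of a connected graded bialgebra -/

section Antipode

open LinearMap WithConv

variable {H ι : Type*} [Ring H] [Bialgebra K H]

variable (K H) in
/-- The difference of the unit and of the identity in the convolution algebra. -/
def convDefect : WithConv (H →ₗ[K] H) := 1 - toConv LinearMap.id

variable {b : Module.Basis ι K H} {deg : ι → ℕ}

theorem map_eq_map_of_mem_span {M N : Type*} [AddCommGroup M] [Module K M] [AddCommGroup N]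
    [Module K N] {s : Set (M ⊗[K] M)} {f g : M ⊗[K] M →ₗ[K] N}
    (h : ∀ x ∈ s, f x = g x) {t : M ⊗[K] M} (ht : t ∈ Submodule.span K s) : f t = g t :=
  LinearMap.eqOn_span (f := f) (g := g) (s := s) h ht

/-- In each term of the coproduct, either the left factor has degree `0`, equals `1` and is killed
by `1 - id`, or the right factor has smaller degree. Only the coproduct needs to respect the degree:
quasi-shuffle products do not preserve the number of black spots. -/
theorem convDefect_pow_apply
    (hΔ : ∀ i, Coalgebra.comul (R := K) (b i) ∈
      Submodule.span K {t | ∃ j k, deg j + deg k = deg i ∧ t = b j ⊗ₜ[K] b k})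
    (h0 : ∀ i, deg i = 0 → b i = 1) (n : ℕ) (i : ι) (hi : deg i < n) :
    (convDefect K H ^ n) (b i) = 0 := by
  induction n generalizing i with
  | zero => omega
  | succ n ih =>
    rw [pow_succ', convMul_apply]
    refine map_eq_map_of_mem_span
      (f := mul' K H ∘ₗ TensorProduct.map (convDefect K H).ofConv (convDefect K H ^ n).ofConv)
      (g := 0) ?_ (hΔ i)
    rintro _ ⟨j, k, hjk, rfl⟩
    simp only [LinearMap.comp_apply, TensorProduct.map_tmul, mul'_apply, LinearMap.zero_apply]
    rcases Nat.eq_zero_or_pos (deg j) with hj | hj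
    · have : (convDefect K H).ofConv (b j) = 0 := by
        rw [h0 j hj, convDefect]
        simp [LinearMap.convOne_def]
      rw [this, zero_mul]
    · have : (convDefect K H ^ n).ofConv (b k) = 0 := ih k (by omega)
      rw [this, mul_zero]

variable (b deg) in
/-- The geometric series that inverts the identity in the convolution algebra. -/
def geomAntipode : H →ₗ[K] H :=
  b.constr K fun i => ∑ m ∈ Finset.range (deg i + 1), (convDefect K H ^ m).ofConv (b i)

/-- Higher powers vanish on `b i`, so one truncated series serves for all factors in the coproduct
of a given basis vector. -/
theorem geomAntipode_apply
    (hΔ : ∀ i, Coalgebra.comul (R := K) (b i) ∈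
      Submodule.span K {t | ∃ j k, deg j + deg k = deg i ∧ t = b j ⊗ₜ[K] b k})
    (h0 : ∀ i, deg i = 0 → b i = 1) {n : ℕ} {i : ι} (hi : deg i ≤ n) :
    geomAntipode b deg (b i) =
      (∑ m ∈ Finset.range (n + 1), convDefect K H ^ m).ofConv (b i) := by
  rw [geomAntipode, Module.Basis.constr_basis]
  have : (∑ m ∈ Finset.range (n + 1), convDefect K H ^ m).ofConv (b i) =
      ∑ m ∈ Finset.range (n + 1), (convDefect K H ^ m).ofConv (b i) := by
    simp [LinearMap.sum_apply]
  rw [this]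
  refine Finset.sum_subset (Finset.range_subset_range.2 (by omega)) fun m _ hm => ?_
  exact convDefect_pow_apply hΔ h0 m i (by simpa using hm)

variable (b deg) in
/-- A bialgebra with a basis graded by the natural numbers, such that the comultiplication
preserves the degree and the only basis vector of degree `0` is `1`, is a Hopf algebra. -/
abbrev hopfAlgebraOfConnected
    (hΔ : ∀ i, Coalgebra.comul (R := K) (b i) ∈
      Submodule.span K {t | ∃ j k, deg j + deg k = deg i ∧ t = b j ⊗ₜ[K] b k})
    (h0 : ∀ i, deg i = 0 → b i = 1) : HopfAlgebra K H where
  antipode := geomAntipode b deg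
  mul_antipode_rTensor_comul := by
    refine b.ext fun i => ?_
    set G := ∑ m ∈ Finset.range (deg i + 1), convDefect K H ^ m
    -- The identity is `1 - convDefect`, so this is a telescoping geometric sum; its last power
    -- vanishes on `b i`.
    have e : G * toConv LinearMap.id = 1 - convDefect K H ^ (deg i + 1) := by
      rw [← geom_sum_mul_neg]
      simp [G, convDefect]
    have e' := congrArg (fun F => F (b i)) e
    have h1 := convDefect_pow_apply hΔ h0 (deg i + 1) i (by omega)
    have h2 : (1 - convDefect K H ^ (deg i + 1)) (b i) =
      (1 : WithConv (H →ₗ[K] H)) (b i) - (convDefect K H ^ (deg i + 1)) (b i) := rfl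
    simp only [h2, h1, sub_zero, convMul_apply] at e'
    refine Eq.trans ?_ e'
    refine map_eq_map_of_mem_span
      (f := mul' K H ∘ₗ (geomAntipode b deg).rTensor H)
      (g := mul' K H ∘ₗ TensorProduct.map G.ofConv LinearMap.id) ?_ (hΔ i)
    rintro _ ⟨j, k, hjk, rfl⟩
    simp only [LinearMap.comp_apply, TensorProduct.map_tmul, LinearMap.rTensor_tmul]
    rw [geomAntipode_apply hΔ h0 (show deg j ≤ deg i by omega)]
    rfl
  mul_antipode_lTensor_comul := by
    refine b.ext fun i => ?_
    set G := ∑ m ∈ Finset.range (deg i + 1), convDefect K H ^ m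
    have e : toConv LinearMap.id * G = 1 - convDefect K H ^ (deg i + 1) := by
      rw [← mul_neg_geom_sum]
      simp [G, convDefect]
    have e' := congrArg (fun F => F (b i)) e
    have h1 := convDefect_pow_apply hΔ h0 (deg i + 1) i (by omega)
    have h2 : (1 - convDefect K H ^ (deg i + 1)) (b i) =
      (1 : WithConv (H →ₗ[K] H)) (b i) - (convDefect K H ^ (deg i + 1)) (b i) := rfl
    simp only [h2, h1, sub_zero, convMul_apply] at e'
    refine Eq.trans ?_ e'
    refine map_eq_map_of_mem_span
      (f := mul' K H ∘ₗ (geomAntipode b deg).lTensor H)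
      (g := mul' K H ∘ₗ TensorProduct.map LinearMap.id G.ofConv) ?_ (hΔ i)
    rintro _ ⟨j, k, hjk, rfl⟩
    simp only [LinearMap.comp_apply, TensorProduct.map_tmul, LinearMap.lTensor_tmul]
    rw [geomAntipode_apply hΔ h0 (show deg k ≤ deg i by omega)]
    rfl

end Antipode

/-! ### Hopf algebra structures on the free module on diagrams -/

/-- The laws of a bialgebra on the free module on diagrams whose unit is the empty diagram and
whose comultiplication preserves the number of black spots. -/
structure HopfOps.IsConnectedBialgebra (A : HopfOps K) : Prop where
  one_eq : A.one = Finsupp.single LDiag.empty 1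
  counit_eq : A.counit = constTerm
  mul_assoc : ∀ x y z, A.mul (A.mul x y) z = A.mul x (A.mul y z)
  one_mul : ∀ x, A.mul A.one x = x
  mul_one : ∀ x, A.mul x A.one = x
  coassoc : (TensorProduct.assoc K _ _ _).toLinearMap ∘ₗ A.comul.rTensor _ ∘ₗ A.comul =
    A.comul.lTensor _ ∘ₗ A.comul
  rTensor_counit : A.counit.rTensor _ ∘ₗ A.comul = TensorProduct.mk K _ _ 1
  lTensor_counit : A.counit.lTensor _ ∘ₗ A.comul = (TensorProduct.mk K _ _).flip 1
  comul_one : A.comul A.one = A.one ⊗ₜ[K] A.one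
  comul_mul : ∀ x y, A.comul (A.mul x y) = TensorProduct.map₂ A.mul A.mul (A.comul x) (A.comul y)
  counit_mul : ∀ x y, A.counit (A.mul x y) = A.counit x * A.counit y
  comul_mem : ∀ d, A.comul (Finsupp.single d 1) ∈ Submodule.span K
    {t | ∃ e f : LDiag, e.p + f.p = d.p ∧ t = Finsupp.single e 1 ⊗ₜ[K] Finsupp.single f 1}

/-- The free module on diagrams, as the underlying type of a bialgebra. -/
def HopfOps.Carrier {A : HopfOps K} (_ : A.IsConnectedBialgebra) : Type _ := LDiag →₀ K

namespace HopfOps.Carrier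

variable {A : HopfOps K} (h : A.IsConnectedBialgebra)

instance : AddCommGroup (Carrier h) := inferInstanceAs (AddCommGroup (LDiag →₀ K))

instance : Module K (Carrier h) := inferInstanceAs (Module K (LDiag →₀ K))

/-- The identity, as a linear equivalence onto the carrier. -/
def equiv : (LDiag →₀ K) ≃ₗ[K] Carrier h := LinearEquiv.refl K (LDiag →₀ K)

instance : Ring (Carrier h) where
  __ := (inferInstance : AddCommGroup (Carrier h))
  mul x y := A.mul x y
  one := A.one
  mul_assoc := h.mul_assoc
  one_mul := h.one_mul
  mul_one := h.mul_one
  left_distrib x y z := map_add (A.mul x) y z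
  right_distrib x y z := LinearMap.map_add₂ A.mul x y z
  zero_mul x := LinearMap.map_zero₂ A.mul x
  mul_zero x := map_zero (A.mul x)

instance : Algebra K (Carrier h) :=
  Algebra.ofModule (fun r x y => LinearMap.map_smul₂ A.mul r x y) fun r x y =>
    map_smul (A.mul x) r y

instance : Coalgebra K (Carrier h) where
  comul := A.comul
  counit := A.counit
  coassoc := h.coassoc
  rTensor_counit_comp_comul := h.rTensor_counit
  lTensor_counit_comp_comul := h.lTensor_counit

theorem mul_tensor_eq (s t : Carrier h ⊗[K] Carrier h) :
    s * t = TensorProduct.map₂ (LinearMap.mul K (Carrier h)) (LinearMap.mul K (Carrier h)) s t := by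
  induction s with
  | zero => simp
  | add x y hx hy => simp only [add_mul, hx, hy, map_add, LinearMap.add_apply]
  | tmul a b =>
    induction t with
    | zero => simp
    | add x y hx hy => simp only [mul_add, hx, hy, map_add]
    | tmul c d => simp

instance : Bialgebra K (Carrier h) :=
  Bialgebra.mk' K (Carrier h)
    (by
      show A.counit A.one = 1
      rw [h.counit_eq, h.one_eq]; simp [constTerm])
    (fun {x y} => h.counit_mul x y)
    h.comul_one
    (fun {x y} => (h.comul_mul x y).trans (mul_tensor_eq h _ _).symm)

end HopfOps.Carrier

theorem HopfOps.IsConnectedBialgebra.isHopfAlgebra {K : Type u} [CommRing K] {A : HopfOps K}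
    (h : A.IsConnectedBialgebra) : A.IsHopfAlgebra := by
  let b : Module.Basis LDiag K (HopfOps.Carrier h) :=
    Module.Basis.ofRepr (HopfOps.Carrier.equiv h).symm
  have hb : ∀ d, b d = HopfOps.Carrier.equiv h (Finsupp.single d 1) := fun d => rfl
  refine ⟨HopfOps.Carrier h, inferInstance,
    hopfAlgebraOfConnected b LDiag.p ?_ ?_, HopfOps.Carrier.equiv h, ?_, ?_, ?_, ?_⟩
  · intro d
    exact h.comul_mem d
  · intro d hd
    rw [LDiag.p_eq_zero] at hd
    subst hd
    exact h.one_eq.symm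
  · exact fun x y => rfl
  · rfl
  · intro x
    have : TensorProduct.map (HopfOps.Carrier.equiv h).toLinearMap
      (HopfOps.Carrier.equiv h).toLinearMap (A.comul x) = A.comul x :=
        LinearMap.congr_fun (TensorProduct.map_id (R := K) (M := LDiag →₀ K)
          (N := LDiag →₀ K)) (A.comul x)
    rw [this]
    rfl
  · exact fun x => rfl

theorem HopfOps.IsHopfAlgebra.of_isIsomorphic {K : Type u} [CommRing K] {A B : HopfOps K}
    (hB : B.IsHopfAlgebra) (h : A.IsIsomorphic B) : A.IsHopfAlgebra := by
  obtain ⟨H, i1, i2, e, h1, h2, h3, h4⟩ := hB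
  obtain ⟨f, g1, g2, g3, g4⟩ := h
  refine ⟨H, i1, i2, f.trans e, fun x y => ?_, ?_, fun x => ?_, fun x => ?_⟩
  · simp [g1, h1]
  · simp [g2, h2]
  · rw [LinearEquiv.trans_apply, h3, g3, LinearEquiv.coe_trans, TensorProduct.map_comp]
    rfl
  · simp [g4, h4]

theorem HopfOps.IsIsomorphic.trans {A B C : HopfOps K} (h : A.IsIsomorphic B)
    (h' : B.IsIsomorphic C) : A.IsIsomorphic C := by
  obtain ⟨e, h1, h2, h3, h4⟩ := h'
  obtain ⟨f, g1, g2, g3, g4⟩ := h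
  refine ⟨f.trans e, fun x y => ?_, ?_, fun x => ?_, fun x => ?_⟩
  · simp [g1, h1]
  · simp [g2, h2]
  · rw [LinearEquiv.trans_apply, h3, g3, LinearEquiv.coe_trans, TensorProduct.map_comp]
    rfl
  · simp [g4, h4]

/-! ### Coproducts given by splittings of lists -/

section ListSum

variable {M N : Type*} [AddCommMonoid M] [Module K M] [AddCommMonoid N] [Module K N]

theorem tmul_listSum (x : M) (l : List N) : x ⊗ₜ[K] l.sum = (l.map fun y => x ⊗ₜ[K] y).sum :=
  map_list_sum (TensorProduct.mk K M N x) l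

theorem listSum_tmul (l : List M) (y : N) : l.sum ⊗ₜ[K] y = (l.map fun x => x ⊗ₜ[K] y).sum :=
  map_list_sum ((TensorProduct.mk K M N).flip y) l

theorem listSum_apply (l : List (M →ₗ[K] N)) (x : M) : l.sum x = (l.map fun f => f x).sum :=
  map_list_sum (LinearMap.applyₗ (R := K) (M₂ := N) x) l

end ListSum

/-- A coassociative, counital and natural way of splitting lists of monomials in two sublists. -/
structure IsSplitting.{v} (s : List Mon → List (List Mon × List Mon)) : Prop where
  nil : s [] = [([], [])]
  relabel_eq : ∀ f u, s (relabel f u) = (s u).map (Prod.map (relabel f) (relabel f))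
  sublist : ∀ u, ∀ p ∈ s u, p.1.Sublist u ∧ p.2.Sublist u
  length_add : ∀ u, ∀ p ∈ s u, p.1.length + p.2.length = u.length
  coassoc : ∀ {M : Type v} [AddCommMonoid M] (F : List Mon → List Mon → List Mon → M) (u),
    ((s u).map fun p => ((s p.1).map fun q => F q.1 q.2 p.2).sum).sum =
      ((s u).map fun p => ((s p.2).map fun q => F p.1 q.1 q.2).sum).sum
  counit_left : ∀ {M : Type v} [AddCommMonoid M] (F : List Mon → M) (u),
    ((s u).map fun p => if p.1 = [] then F p.2 else 0).sum = F u
  counit_right : ∀ {M : Type v} [AddCommMonoid M] (F : List Mon → M) (u),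
    ((s u).map fun p => if p.2 = [] then F p.1 else 0).sum = F u

variable (K) in
/-- The coproduct on lists defined by a splitting. -/
def splitL (s : List Mon → List (List Mon × List Mon)) :
    (List Mon →₀ K) →ₗ[K] (List Mon →₀ K) ⊗[K] (List Mon →₀ K) :=
  Finsupp.linearCombination K fun u =>
    ((s u).map fun p => Finsupp.single p.1 (1 : K) ⊗ₜ[K] Finsupp.single p.2 (1 : K)).sum

@[simp]
theorem splitL_single (s : List Mon → List (List Mon × List Mon)) (u : List Mon) :
    splitL K s (Finsupp.single u 1) =
      ((s u).map fun p => Finsupp.single p.1 (1 : K) ⊗ₜ[K] Finsupp.single p.2 (1 : K)).sum := by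
  simp [splitL]

/-- Compatibility of a splitting with a twisted law. -/
def IsMultiplicative (s : List Mon → List (List Mon × List Mon)) (qc qs : K) : Prop :=
  ∀ u v, 0 ∉ u → 0 ∉ v → splitL K s (twisted qc qs u v) =
    ((s u).map fun p => ((s v).map fun q =>
      twisted qc qs p.1 q.1 ⊗ₜ[K] twisted qc qs p.2 q.2).sum).sum

variable (K) in
/-- The coproduct on diagrams defined by a splitting of lists. -/
def packComul (s : List Mon → List (List Mon × List Mon)) :
    (LDiag →₀ K) →ₗ[K] (LDiag →₀ K) ⊗[K] (LDiag →₀ K) :=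
  Finsupp.linearCombination K fun d => ((s d.code).map fun p =>
    Finsupp.single (packList p.1) (1 : K) ⊗ₜ[K] Finsupp.single (packList p.2) (1 : K)).sum

theorem packComul_single (s : List Mon → List (List Mon × List Mon)) (d : LDiag) :
    packComul K s (Finsupp.single d 1) = ((s d.code).map fun p =>
      Finsupp.single (packList p.1) (1 : K) ⊗ₜ[K] Finsupp.single (packList p.2) (1 : K)).sum := by
  simp [packComul]

namespace IsSplitting

variable {s : List Mon → List (List Mon × List Mon)} (hs : IsSplitting s)

include hs

theorem zero_notMem {u : List Mon} (hu : 0 ∉ u) {p : List Mon × List Mon} (hp : p ∈ s u) :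
    0 ∉ p.1 ∧ 0 ∉ p.2 :=
  ⟨fun h => hu ((hs.sublist u p hp).1.subset h), fun h => hu ((hs.sublist u p hp).2.subset h)⟩

/-- Splitting commutes with relabelling, and ranks in `used u` increase along the variables of each
part. Packing before the splitting is thus absorbed by packing after it. -/
theorem packComul_packList {u : List Mon} (hu : 0 ∉ u) :
    packComul K s (Finsupp.single (packList u) 1) = ((s u).map fun p =>
      Finsupp.single (packList p.1) (1 : K) ⊗ₜ[K] Finsupp.single (packList p.2) (1 : K)).sum := by
  rw [packComul_single, code_packList hu, std, hs.relabel_eq, List.map_map]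
  congr 1
  refine List.map_congr_left fun p hp => ?_
  have h0 := hs.zero_notMem hu hp
  have hsub := hs.sublist u p hp
  simp only [Function.comp_apply, Prod.map_fst, Prod.map_snd]
  rw [packList_relabel h0.1, packList_relabel h0.2]
  · exact (rankIn_strictMonoOn _).mono (used_mono hsub.2.subset)
  · exact (rankIn_strictMonoOn _).mono (used_mono hsub.1.subset)

theorem packComul_packL {x : List Mon →₀ K} (hx : x ∈ Finsupp.supported K K {u | 0 ∉ u}) :
    packComul K s (packL K x) = TensorProduct.map (packL K) (packL K) (splitL K s x) := by
  refine eq_of_mem_supported (f := packComul K s ∘ₗ packL K)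
    (g := TensorProduct.map (packL K) (packL K) ∘ₗ splitL K s) (fun u hu => ?_) hx
  simp only [LinearMap.comp_apply, packL_single, splitL_single, hs.packComul_packList hu,
    map_list_sum, List.map_map]
  congr 1
  refine List.map_congr_left fun p _ => ?_
  simp

/-- The parts of `d.code` may use fewer variables than `d.code` itself, but all lie below `d.q`;
`deformedMul_packList` allows the common shift `d.q` for every part, which reduces the claim to
lists. -/
theorem packComul_mul {qc qs : K} (hm : IsMultiplicative s qc qs) (x y : LDiag →₀ K) :
    packComul K s (deformedMul qc qs x y) =
      TensorProduct.map₂ (deformedMul qc qs) (deformedMul qc qs)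
        (packComul K s x) (packComul K s y) := by
  have key : (deformedMul qc qs).compr₂ (packComul K s) =
      (TensorProduct.map₂ (deformedMul qc qs) (deformedMul qc qs)).compl₁₂
        (packComul K s) (packComul K s) := by
    refine bilin_ext fun d e => ?_
    simp only [LinearMap.compr₂_apply, LinearMap.compl₁₂_apply]
    have h0 := d.zero_notMem_code
    have h0' : 0 ∉ translate d.q e.code := zero_notMem_relabel e.zero_notMem_code
    rw [deformedMul_single, hs.packComul_packL (Finsupp.supported_mono
      (fun w hw => QShuffle.zero_notMem hw h0 h0') (twisted_mem_supported qc qs _ _)),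
      hm _ _ h0 h0', packComul_single, packComul_single, translate_eq_relabel, hs.relabel_eq]
    rw [map_list_sum (TensorProduct.map (packL K) (packL K)),
      map_list_sum (TensorProduct.map₂ (deformedMul qc qs) (deformedMul qc qs)), listSum_apply,
      List.map_map, List.map_map, List.map_map]
    congr 1
    refine List.map_congr_left fun p hp => ?_
    simp only [Function.comp_apply, map_list_sum, List.map_map]
    congr 1
    refine List.map_congr_left fun q hq => ?_
    have hp0 := hs.zero_notMem h0 hp
    have hq0 := hs.zero_notMem e.zero_notMem_code hq
    have hsub := hs.sublist _ p hp
    simp only [Function.comp_apply, Prod.map_fst, Prod.map_snd, TensorProduct.map_tmul,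
      TensorProduct.map₂_apply_tmul, ← translate_eq_relabel]
    rw [deformedMul_packList qc qs hp0.1 hq0.1
        ((used_mono hsub.1.subset).trans d.used_code.subset),
      deformedMul_packList qc qs hp0.2 hq0.2
        ((used_mono hsub.2.subset).trans d.used_code.subset)]
  exact LinearMap.congr_fun₂ key x y

end IsSplitting

theorem constTerm_single (d : LDiag) [Decidable (d = LDiag.empty)] :
    constTerm (Finsupp.single d (1 : K)) = if d = LDiag.empty then 1 else 0 := by
  simp [constTerm, Finsupp.single_apply]

theorem packList_eq_empty {u : List Mon} (hu : 0 ∉ u) : packList u = LDiag.empty ↔ u = [] := by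
  rw [← LDiag.p_eq_zero, p_packList hu, List.length_eq_zero_iff]

theorem QShuffle.eq_nil {u v w : List Mon} (h : QShuffle u v w) : w = [] ↔ u = [] ∧ v = [] := by
  cases h <;> simp

/-- A quasi-shuffle is empty only if both of its arguments are. -/
theorem constTerm_deformedMul (qc qs : K) (x y : LDiag →₀ K) :
    constTerm (deformedMul qc qs x y) = constTerm x * constTerm y := by
  classical
  have key : (deformedMul qc qs).compr₂ constTerm =
      (LinearMap.mul K K).compl₁₂ constTerm constTerm := by
    refine bilin_ext fun d e => ?_
    simp only [LinearMap.compr₂_apply, LinearMap.compl₁₂_apply, LinearMap.mul_apply',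
      constTerm_single]
    by_cases hd : d = LDiag.empty
    · subst hd
      rw [deformedMul_one_left]
      simp [constTerm_single]
    · have := deformedMul_single_mem_supported qc qs d e
      rw [if_neg hd, zero_mul]
      by_contra hne
      have := (this (Finsupp.mem_support_iff.2 hne)).eq_nil.1 LDiag.code_empty
      exact hd (LDiag.code_eq_nil.1 this.1)
  exact LinearMap.congr_fun₂ key x y

/-- The deformed algebra with the coproduct given by a compatible splitting is a bialgebra. -/
theorem isConnectedBialgebra_of_isSplitting {K : Type u} [CommRing K]
    {s : List Mon → List (List Mon × List Mon)} (hs : IsSplitting.{u} s) {qc qs : K}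
    (hm : IsMultiplicative s qc qs) {A : HopfOps K} (hmul : A.mul = deformedMul qc qs)
    (hone : A.one = Finsupp.single LDiag.empty 1) (hcomul : A.comul = packComul K s)
    (hcounit : A.counit = constTerm) : A.IsConnectedBialgebra where
  one_eq := hone
  counit_eq := hcounit
  mul_assoc x y z := by rw [hmul, deformedMul_assoc]
  one_mul x := by rw [hmul, hone, deformedMul_one_left]
  mul_one x := by rw [hmul, hone, deformedMul_one_right]
  coassoc := by
    rw [hcomul]
    refine Finsupp.lhom_ext' fun d => LinearMap.ext_ring ?_
    simp only [LinearMap.comp_apply, Finsupp.lsingle_apply, packComul_single, map_list_sum,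
      List.map_map, LinearEquiv.coe_coe]
    have e1 : ∀ p ∈ s d.code, ((TensorProduct.assoc K (LDiag →₀ K) (LDiag →₀ K) (LDiag →₀ K)) ∘
        ((packComul K s).rTensor (LDiag →₀ K)) ∘ fun p : List Mon × List Mon =>
          Finsupp.single (packList p.1) (1 : K) ⊗ₜ[K] Finsupp.single (packList p.2) (1 : K)) p =
        ((s p.1).map fun q => Finsupp.single (packList q.1) (1 : K) ⊗ₜ[K]
          (Finsupp.single (packList q.2) (1 : K) ⊗ₜ[K]
            Finsupp.single (packList p.2) (1 : K))).sum := by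
      intro p hp
      simp only [Function.comp_apply, LinearMap.rTensor_tmul,
        hs.packComul_packList (hs.zero_notMem d.zero_notMem_code hp).1,
        listSum_tmul, map_list_sum, List.map_map]
      rfl
    have e2 : ∀ p ∈ s d.code, (((packComul K s).lTensor (LDiag →₀ K)) ∘
        fun p : List Mon × List Mon =>
          Finsupp.single (packList p.1) (1 : K) ⊗ₜ[K] Finsupp.single (packList p.2) (1 : K)) p =
        ((s p.2).map fun q => Finsupp.single (packList p.1) (1 : K) ⊗ₜ[K]
          (Finsupp.single (packList q.1) (1 : K) ⊗ₜ[K]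
            Finsupp.single (packList q.2) (1 : K))).sum := by
      intro p hp
      simp only [Function.comp_apply, LinearMap.lTensor_tmul,
        hs.packComul_packList (hs.zero_notMem d.zero_notMem_code hp).2,
        tmul_listSum, List.map_map]
      rfl
    rw [List.map_congr_left e1, List.map_congr_left e2]
    exact hs.coassoc (fun x y z => Finsupp.single (packList x) (1 : K) ⊗ₜ[K]
      (Finsupp.single (packList y) (1 : K) ⊗ₜ[K] Finsupp.single (packList z) (1 : K))) d.code
  rTensor_counit := by
    classical
    rw [hcomul, hcounit]
    refine Finsupp.lhom_ext' fun d => LinearMap.ext_ring ?_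
    simp only [LinearMap.comp_apply, Finsupp.lsingle_apply, packComul_single, map_list_sum,
      List.map_map]
    rw [List.map_congr_left (g := fun p => if p.1 = [] then
      (1 : K) ⊗ₜ[K] Finsupp.single (packList p.2) (1 : K) else 0), hs.counit_left
      fun z => (1 : K) ⊗ₜ[K] Finsupp.single (packList z) (1 : K), packList_code]
    · rfl
    · intro p hp
      have h0 := hs.zero_notMem d.zero_notMem_code hp
      simp only [Function.comp_apply, LinearMap.rTensor_tmul, constTerm_single,
        packList_eq_empty h0.1]
      split_ifs <;> simp
  lTensor_counit := by
    classical
    rw [hcomul, hcounit]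
    refine Finsupp.lhom_ext' fun d => LinearMap.ext_ring ?_
    simp only [LinearMap.comp_apply, Finsupp.lsingle_apply, packComul_single, map_list_sum,
      List.map_map]
    rw [List.map_congr_left (g := fun p => if p.2 = [] then
      Finsupp.single (packList p.1) (1 : K) ⊗ₜ[K] (1 : K) else 0), hs.counit_right
      fun z => Finsupp.single (packList z) (1 : K) ⊗ₜ[K] (1 : K), packList_code]
    · rfl
    · intro p hp
      have h0 := hs.zero_notMem d.zero_notMem_code hp
      simp only [Function.comp_apply, LinearMap.lTensor_tmul, constTerm_single,
        packList_eq_empty h0.2]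
      split_ifs <;> simp
  comul_one := by
    rw [hcomul, hone, packComul_single, LDiag.code_empty, hs.nil]
    simp
  comul_mul x y := by rw [hmul, hcomul, hs.packComul_mul hm]
  counit_mul x y := by rw [hmul, hcounit, constTerm_deformedMul]
  comul_mem d := by
    rw [hcomul, packComul_single]
    refine list_sum_mem fun t ht => ?_
    obtain ⟨p, hp, rfl⟩ := List.mem_map.1 ht
    have h0 := hs.zero_notMem d.zero_notMem_code hp
    refine Submodule.subset_span ⟨_, _, ?_, rfl⟩
    rw [p_packList h0.1, p_packList h0.2, hs.length_add _ _ hp, LDiag.length_code]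

/-! ### Deconcatenation and unshuffling -/

/-- The ways to cut a list in a beginning and an end. -/
def cut : List Mon → List (List Mon × List Mon)
  | [] => [([], [])]
  | a :: u => ([], a :: u) :: (cut u).map (Prod.map (List.cons a) id)

/-- The ways to split a list in two complementary sublists. -/
def unshuffle : List Mon → List (List Mon × List Mon)
  | [] => [([], [])]
  | a :: u => (unshuffle u).map (Prod.map (List.cons a) id) ++
      (unshuffle u).map (Prod.map id (List.cons a))

theorem isSplitting_cut : IsSplitting cut where
  nil := rfl
  relabel_eq f u := by
    induction u with
    | nil => rfl
    | cons a u ih =>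
      rw [relabel_cons, cut, ih, cut]
      simp [Function.comp_def]
  sublist u := by
    induction u with
    | nil => simp [cut]
    | cons a u ih =>
      intro p hp
      simp only [cut, List.mem_cons, List.mem_map] at hp
      rcases hp with rfl | ⟨q, hq, rfl⟩
      · simp
      · exact ⟨(ih q hq).1.cons_cons a, (ih q hq).2.cons a⟩
  length_add u := by
    induction u with
    | nil => simp [cut]
    | cons a u ih =>
      intro p hp
      simp only [cut, List.mem_cons, List.mem_map] at hp
      rcases hp with rfl | ⟨q, hq, rfl⟩
      · simp
      · have := ih q hq
        simp only [Prod.map_fst, List.length_cons, Prod.map_snd, id_eq]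
        omega
  coassoc F u := by
    induction u generalizing F with
    | nil => rfl
    | cons a u ih =>
      -- The letter `a` is absorbed into the function, hence the induction over all `F`.
      have := ih fun x y z => F (a :: x) y z
      simp only [cut, List.map_cons, List.map_map, List.sum_cons, Function.comp_def, Prod.map_fst,
        Prod.map_snd, id_eq, List.map_nil, List.sum_nil, add_zero, List.sum_map_add, this,
        add_assoc]
  counit_left F u := by
    cases u with
    | nil => simp [cut]
    | cons a u => simp [cut, Function.comp_def]
  counit_right F u := by
    induction u generalizing F with
    | nil => simp [cut]
    | cons a u ih => simpa [cut, Function.comp_def] using ih fun x => F (a :: x)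

theorem isSplitting_unshuffle : IsSplitting unshuffle where
  nil := rfl
  relabel_eq f u := by
    induction u with
    | nil => rfl
    | cons a u ih =>
      rw [relabel_cons, unshuffle, ih, unshuffle]
      simp [Function.comp_def, Prod.map]
  sublist u := by
    induction u with
    | nil => simp [unshuffle]
    | cons a u ih =>
      intro p hp
      simp only [unshuffle, List.mem_append, List.mem_map] at hp
      rcases hp with ⟨q, hq, rfl⟩ | ⟨q, hq, rfl⟩
      · exact ⟨(ih q hq).1.cons_cons a, (ih q hq).2.cons a⟩
      · exact ⟨(ih q hq).1.cons a, (ih q hq).2.cons_cons a⟩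
  length_add u := by
    induction u with
    | nil => simp [unshuffle]
    | cons a u ih =>
      intro p hp
      simp only [unshuffle, List.mem_append, List.mem_map] at hp
      rcases hp with ⟨q, hq, rfl⟩ | ⟨q, hq, rfl⟩
      all_goals
        have := ih q hq
        simp only [Prod.map_fst, List.length_cons, Prod.map_snd, id_eq]
        omega
  coassoc F u := by
    induction u generalizing F with
    | nil => rfl
    | cons a u ih =>
      -- The letter `a` falls into one of the three parts.
      have h1 := ih fun x y z => F (a :: x) y z
      have h2 := ih fun x y z => F x (a :: y) z
      have h3 := ih fun x y z => F x y (a :: z)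
      simp only [unshuffle, List.map_append, List.sum_append, List.map_map, Function.comp_def,
        Prod.map_fst, Prod.map_snd, id_eq, List.sum_map_add, h1, h2, h3, add_assoc]
  counit_left F u := by
    induction u generalizing F with
    | nil => simp [unshuffle]
    | cons a u ih => simpa [unshuffle, Function.comp_def] using ih fun x => F (a :: x)
  counit_right F u := by
    induction u generalizing F with
    | nil => simp [unshuffle]
    | cons a u ih => simpa [unshuffle, Function.comp_def] using ih fun x => F (a :: x)

/-- Positive degrees make the power of `q_c` in the second term and that of `q_s` in the third
vanish. A unit monomial would bring in `0 ^ 0 = 1`, hence the hypotheses. -/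
theorem twisted_zero_zero {u v : List Mon} (hu : 0 ∉ u) (hv : 0 ∉ v) :
    twisted (0 : K) 0 u v = Finsupp.single (u ++ v) 1 := by
  induction u with
  | nil => simp [twisted_nil_left]
  | cons a u ih =>
    simp only [List.mem_cons, not_or] at hu
    cases v with
    | nil => simp [twisted_nil_right]
    | cons b v =>
      simp only [List.mem_cons, not_or] at hv
      have ha : a.degree ≠ 0 := fun h => hu.1 ((Finsupp.degree_eq_zero_iff a).1 h).symm
      have hb : b.degree ≠ 0 := fun h => hv.1 ((Finsupp.degree_eq_zero_iff b).1 h).symm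
      rw [twisted_cons_cons, ih hu.2, zero_pow (n := listWeight (a :: u) * b.degree),
        zero_pow (n := a.degree * b.degree)]
      · simp
      · exact mul_ne_zero ha hb
      · rw [listWeight_cons]
        exact mul_ne_zero (by omega) hb

theorem isMultiplicative_unshuffle : IsMultiplicative unshuffle (0 : K) 0 := by
  intro u v hu hv
  rw [twisted_zero_zero hu hv, splitL_single]
  have h0 := fun p hp => isSplitting_unshuffle.{0}.zero_notMem hu (p := p) hp
  have h1 := fun p hp => isSplitting_unshuffle.{0}.zero_notMem hv (p := p) hp
  -- Splitting `u ++ v` amounts to splitting `u` and `v` independently.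
  have step : ∀ (G : List Mon → List Mon → (List Mon →₀ K) ⊗[K] (List Mon →₀ K)),
      ((unshuffle (u ++ v)).map fun p => G p.1 p.2).sum =
        ((unshuffle u).map fun p => ((unshuffle v).map fun q =>
          G (p.1 ++ q.1) (p.2 ++ q.2)).sum).sum := by
    clear hu h0
    induction u with
    | nil => intro G; simp [unshuffle]
    | cons a u ih =>
      intro G
      have e1 := ih fun x y => G (a :: x) y
      have e2 := ih fun x y => G x (a :: y)
      simp only [List.cons_append, unshuffle, List.map_append, List.sum_append, List.map_map,
        Function.comp_def, Prod.map_fst, Prod.map_snd, id_eq, e1, e2]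
  rw [step fun x y => Finsupp.single x (1 : K) ⊗ₜ[K] Finsupp.single y (1 : K)]
  congr 1
  refine List.map_congr_left fun p hp => ?_
  congr 1
  refine List.map_congr_left fun q hq => ?_
  rw [twisted_zero_zero (h0 p hp).1 (h1 q hq).1, twisted_zero_zero (h0 p hp).2 (h1 q hq).2]

/-! ### The quasi-shuffle product and deconcatenation -/

variable (K) in
/-- Putting a monomial in front of the first tensor factor. -/
def consL₁ (a : Mon) : (List Mon →₀ K) ⊗[K] (List Mon →₀ K) →ₗ[K]
    (List Mon →₀ K) ⊗[K] (List Mon →₀ K) := (consL K a).rTensor _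

variable (K) in
/-- The componentwise quasi-shuffle product on the tensor square. -/
def tw₂ := TensorProduct.map₂ (tw (1 : K) 1) (tw (1 : K) 1)

/-- Either the cut is made before `a`, or it is made later and `a` heads the left part. -/
theorem splitL_cut_consL (a : Mon) (x : List Mon →₀ K) :
    splitL K cut (consL K a x) =
      Finsupp.single [] 1 ⊗ₜ[K] consL K a x + consL₁ K a (splitL K cut x) := by
  have : splitL K cut ∘ₗ consL K a = TensorProduct.mk K _ _ (Finsupp.single [] 1) ∘ₗ consL K a +
      consL₁ K a ∘ₗ splitL K cut := by
    refine Finsupp.lhom_ext' fun u => LinearMap.ext_ring ?_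
    simp [cut, map_list_sum, consL₁, Function.comp_def]
  exact LinearMap.congr_fun this x

/-- At `(1, 1)` no weights appear, so the recursion is bilinear without any homogeneity condition.
-/
theorem tw_one_consL_consL (a b : Mon) (x y : List Mon →₀ K) :
    tw (1 : K) 1 (consL K a x) (consL K b y) = consL K a (tw (1 : K) 1 x (consL K b y)) +
      consL K b (tw (1 : K) 1 (consL K a x) y) + consL K (a + b) (tw (1 : K) 1 x y) := by
  induction x using Finsupp.induction_linear with
  | zero => simp
  | add x x' hx hy => simp only [map_add, LinearMap.add_apply, hx, hy]; abel
  | single u r =>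
    rw [← mul_one r, ← smul_eq_mul, ← Finsupp.smul_single]
    simp only [map_smul, LinearMap.smul_apply, consL_single, tw_cons_left, one_pow, mul_one,
      one_smul, smul_add]

theorem tw₂_consL₁_consL₁ (a b : Mon) (X Y : (List Mon →₀ K) ⊗[K] (List Mon →₀ K)) :
    tw₂ K (consL₁ K a X) (consL₁ K b Y) = consL₁ K a (tw₂ K X (consL₁ K b Y)) +
      consL₁ K b (tw₂ K (consL₁ K a X) Y) + consL₁ K (a + b) (tw₂ K X Y) := by
  induction X with
  | zero => simp
  | add x x' hx hy => simp only [map_add, LinearMap.add_apply, hx, hy]; abel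
  | tmul x x' =>
    induction Y with
    | zero => simp
    | add y y' hx hy => simp only [map_add, hx, hy]; abel
    | tmul y y' =>
      simp only [tw₂, consL₁, LinearMap.rTensor_tmul, TensorProduct.map₂_apply_tmul,
        TensorProduct.map_tmul, tw_one_consL_consL, TensorProduct.add_tmul]

theorem tw₂_nil_left_consL₁ (b : Mon) (y : List Mon →₀ K)
    (Y : (List Mon →₀ K) ⊗[K] (List Mon →₀ K)) :
    tw₂ K (Finsupp.single [] 1 ⊗ₜ[K] y) (consL₁ K b Y) =
      consL₁ K b (tw₂ K (Finsupp.single [] 1 ⊗ₜ[K] y) Y) := by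
  induction Y with
  | zero => simp
  | add y y' hx hy => simp only [map_add, hx, hy]
  | tmul y y' => simp [tw₂, consL₁]

theorem tw₂_consL₁_nil_left (b : Mon) (y : List Mon →₀ K)
    (Y : (List Mon →₀ K) ⊗[K] (List Mon →₀ K)) :
    tw₂ K (consL₁ K b Y) (Finsupp.single [] 1 ⊗ₜ[K] y) =
      consL₁ K b (tw₂ K Y (Finsupp.single [] 1 ⊗ₜ[K] y)) := by
  induction Y with
  | zero => simp
  | add y y' hx hy => simp only [map_add, LinearMap.add_apply, hx, hy]
  | tmul y y' => simp [tw₂, consL₁]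

/-- Each factor expands as the cut before its first letter plus the later cuts. The product of the
two initial cuts is the initial cut of the product. The remaining products regroup by the first
letter of the left part, `a`, `b` or `a + b`, and give the later cuts by induction. -/
theorem splitL_cut_twisted (u v : List Mon) : splitL K cut (twisted (1 : K) 1 u v) =
    tw₂ K (splitL K cut (Finsupp.single u 1)) (splitL K cut (Finsupp.single v 1)) := by
  have hnil : splitL K cut (Finsupp.single [] 1) =
      Finsupp.single [] 1 ⊗ₜ[K] Finsupp.single [] 1 := by simp [cut]
  have hl : ∀ X, tw₂ K (Finsupp.single [] 1 ⊗ₜ[K] Finsupp.single [] 1) X = X := fun X => by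
    induction X with
    | zero => simp
    | add y y' hx hy => simp only [map_add, hx, hy]
    | tmul y y' => simp [tw₂]
  have hr : ∀ X, tw₂ K X (Finsupp.single [] 1 ⊗ₜ[K] Finsupp.single [] 1) = X := fun X => by
    induction X with
    | zero => simp
    | add y y' hx hy => simp only [map_add, LinearMap.add_apply, hx, hy]
    | tmul y y' => simp [tw₂]
  induction u, v using twisted_induction with
  | nil_left w => rw [twisted_nil_left, hnil, hl]
  | nil_right w => rw [twisted_nil_right, hnil, hr]
  | cons a u b v h1 h2 h3 =>
    have e : ∀ (a : Mon) u, splitL K cut (Finsupp.single (a :: u) 1) =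
        Finsupp.single [] 1 ⊗ₜ[K] Finsupp.single (a :: u) 1 +
          consL₁ K a (splitL K cut (Finsupp.single u 1)) := fun a u => by
      rw [← consL_single, splitL_cut_consL]
    have e0 : tw₂ K (Finsupp.single [] 1 ⊗ₜ[K] Finsupp.single (a :: u) 1)
        (Finsupp.single [] 1 ⊗ₜ[K] Finsupp.single (b :: v) 1) =
        Finsupp.single [] 1 ⊗ₜ[K] twisted (1 : K) 1 (a :: u) (b :: v) := by
      rw [tw₂, TensorProduct.map₂_apply_tmul, TensorProduct.map_tmul, tw_nil_left, tw_single]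
    have ec := twisted_cons_cons (1 : K) 1 a b u v
    simp only [one_pow, mul_one, one_smul] at ec
    rw [e a u, e b v] at *
    simp only [map_add, LinearMap.add_apply, e0, tw₂_consL₁_consL₁, tw₂_nil_left_consL₁,
      tw₂_consL₁_nil_left, ec, splitL_cut_consL, h1, h2, h3, TensorProduct.tmul_add]
    abel

theorem isMultiplicative_cut : IsMultiplicative cut (1 : K) 1 := by
  intro u v _ _
  rw [splitL_cut_twisted, splitL_single, splitL_single, map_list_sum (tw₂ K), listSum_apply,
    List.map_map, List.map_map]
  congr 1
  refine List.map_congr_left fun p _ => ?_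
  simp only [Function.comp_apply, map_list_sum, List.map_map]
  congr 1
  refine List.map_congr_left fun q _ => ?_
  simp [tw₂]

/-! ### The product of matrix quasi-symmetric functions -/

theorem exists_succ_of_ne_zero {p r : ℕ} {f : Fin p → Fin (r + 1)} (hf : StrictMono f)
    (h : ∀ i, f i ≠ 0) : ∃ f' : Fin p → Fin r, StrictMono f' ∧ f = fun i => (f' i).succ :=
  ⟨fun i => (f i).pred (h i), fun _ _ hij => Fin.pred_lt_pred_iff.2 (hf hij),
    funext fun _ => (Fin.succ_pred _ _).symm⟩

theorem exists_cons_of_eq_zero {p r : ℕ} {f : Fin (p + 1) → Fin (r + 1)} (hf : StrictMono f)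
    (h : f 0 = 0) : ∃ f' : Fin p → Fin r, StrictMono f' ∧
      f = Fin.cons 0 fun i => (f' i).succ := by
  obtain ⟨f', hf', e⟩ := exists_succ_of_ne_zero (f := fun i : Fin p => f i.succ)
    (fun i j hij => hf (Fin.succ_lt_succ_iff.2 hij))
    fun i => (((Fin.zero_le _).trans_lt (hf (Fin.succ_pos i)))).ne'
  refine ⟨f', hf', funext fun i => ?_⟩
  refine Fin.cases ?_ (fun i => ?_) i
  · simpa using h
  · simpa using congrFun e i

theorem strictMono_cons_zero {p r : ℕ} {f : Fin p → Fin r} (hf : StrictMono f) :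
    StrictMono (Fin.cons 0 fun i => (f i).succ : Fin (p + 1) → Fin (r + 1)) := by
  intro i j
  refine Fin.cases ?_ (fun i => ?_) i <;> refine Fin.cases ?_ (fun j => ?_) j
  · simp
  · simp
  · simp
  · intro h
    simpa using hf (Fin.succ_lt_succ_iff.1 h)

theorem strictMono_succ {p r : ℕ} {f : Fin p → Fin r} (hf : StrictMono f) :
    StrictMono fun i => (f i).succ := fun _ _ h => Fin.succ_lt_succ_iff.2 (hf h)

namespace RowInsertion

variable {p p' r : ℕ}

/-- The first row comes from the left matrix only. -/
def consLeft (s : RowInsertion p p' r) : RowInsertion (p + 1) p' (r + 1) :=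
  ⟨(Fin.cons 0 fun i => (s.1.1 i).succ, fun i => (s.1.2 i).succ),
    strictMono_cons_zero s.2.1, strictMono_succ s.2.2.1, fun k => by
      refine Fin.cases (.inl ⟨0, rfl⟩) (fun k => ?_) k
      rcases s.2.2.2 k with ⟨i, hi⟩ | ⟨i, hi⟩
      · exact .inl ⟨i.succ, by simpa using hi⟩
      · exact .inr ⟨i, by simpa using hi⟩⟩

/-- The first row comes from the right matrix only. -/
def consRight (s : RowInsertion p p' r) : RowInsertion p (p' + 1) (r + 1) :=
  ⟨(fun i => (s.1.1 i).succ, Fin.cons 0 fun i => (s.1.2 i).succ),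
    strictMono_succ s.2.1, strictMono_cons_zero s.2.2.1, fun k => by
      refine Fin.cases (.inr ⟨0, rfl⟩) (fun k => ?_) k
      rcases s.2.2.2 k with ⟨i, hi⟩ | ⟨i, hi⟩
      · exact .inl ⟨i, by simpa using hi⟩
      · exact .inr ⟨i.succ, by simpa using hi⟩⟩

/-- The first row comes from both matrices. -/
def consBoth (s : RowInsertion p p' r) : RowInsertion (p + 1) (p' + 1) (r + 1) :=
  ⟨(Fin.cons 0 fun i => (s.1.1 i).succ, Fin.cons 0 fun i => (s.1.2 i).succ),
    strictMono_cons_zero s.2.1, strictMono_cons_zero s.2.2.1, fun k => by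
      refine Fin.cases (.inl ⟨0, rfl⟩) (fun k => ?_) k
      rcases s.2.2.2 k with ⟨i, hi⟩ | ⟨i, hi⟩
      · exact .inl ⟨i.succ, by simpa using hi⟩
      · exact .inr ⟨i.succ, by simpa using hi⟩⟩

theorem succ_comp_injective {f g : Fin p → Fin r}
    (h : (fun i => (f i).succ) = fun i => (g i).succ) : f = g :=
  funext fun i => Fin.succ_injective _ (congrFun h i)

theorem cons_succ_injective {f g : Fin p → Fin r}
    (h : (Fin.cons 0 fun i => (f i).succ : Fin (p + 1) → Fin (r + 1)) =
      Fin.cons 0 fun i => (g i).succ) : f = g :=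
  succ_comp_injective (Fin.cons_right_injective (α := fun _ => Fin (r + 1)) 0 h)

theorem consLeft_injective :
    Function.Injective (consLeft : RowInsertion p p' r → _) := fun _ _ h =>
  Subtype.ext (Prod.ext (cons_succ_injective (congrArg (fun x => x.1.1) h))
    (succ_comp_injective (congrArg (fun x => x.1.2) h)))

theorem consRight_injective :
    Function.Injective (consRight : RowInsertion p p' r → _) := fun _ _ h =>
  Subtype.ext (Prod.ext (succ_comp_injective (congrArg (fun x => x.1.1) h))
    (cons_succ_injective (congrArg (fun x => x.1.2) h)))

theorem consBoth_injective :
    Function.Injective (consBoth : RowInsertion p p' r → _) := fun _ _ h =>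
  Subtype.ext (Prod.ext (cons_succ_injective (congrArg (fun x => x.1.1) h))
    (cons_succ_injective (congrArg (fun x => x.1.2) h)))

theorem ne_zero_of_strictMono {f : Fin (p + 1) → Fin (r + 1)} (hf : StrictMono f) (h : f 0 ≠ 0)
    (i : Fin (p + 1)) : f i ≠ 0 := fun h' =>
  h (le_antisymm (h' ▸ hf.monotone (Fin.zero_le i)) (Fin.zero_le _))

theorem exists_consLeft (s : RowInsertion (p + 1) p' (r + 1)) (h1 : s.1.1 0 = 0)
    (h2 : ∀ i, s.1.2 i ≠ 0) : ∃ t : RowInsertion p p' r, t.consLeft = s := by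
  obtain ⟨⟨f, g⟩, hf, hg, hs⟩ := s
  obtain ⟨f', hf', rfl⟩ := exists_cons_of_eq_zero hf h1
  obtain ⟨g', hg', rfl⟩ := exists_succ_of_ne_zero hg h2
  refine ⟨⟨(f', g'), hf', hg', fun k => ?_⟩, rfl⟩
  rcases hs k.succ with ⟨i, hi⟩ | ⟨i, hi⟩
  · left
    revert hi
    refine Fin.cases (fun h => ?_) (fun i h => ?_) i
    · exact absurd h.symm (Fin.succ_ne_zero k)
    · exact ⟨i, by simpa using h⟩
  · exact .inr ⟨i, by simpa using hi⟩

theorem exists_consRight (s : RowInsertion p (p' + 1) (r + 1)) (h1 : ∀ i, s.1.1 i ≠ 0)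
    (h2 : s.1.2 0 = 0) : ∃ t : RowInsertion p p' r, t.consRight = s := by
  obtain ⟨⟨f, g⟩, hf, hg, hs⟩ := s
  obtain ⟨f', hf', rfl⟩ := exists_succ_of_ne_zero hf h1
  obtain ⟨g', hg', rfl⟩ := exists_cons_of_eq_zero hg h2
  refine ⟨⟨(f', g'), hf', hg', fun k => ?_⟩, rfl⟩
  rcases hs k.succ with ⟨i, hi⟩ | ⟨i, hi⟩
  · exact .inl ⟨i, by simpa using hi⟩
  · right
    revert hi
    refine Fin.cases (fun h => ?_) (fun i h => ?_) i
    · exact absurd h.symm (Fin.succ_ne_zero k)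
    · exact ⟨i, by simpa using h⟩

theorem exists_consBoth (s : RowInsertion (p + 1) (p' + 1) (r + 1)) (h1 : s.1.1 0 = 0)
    (h2 : s.1.2 0 = 0) : ∃ t : RowInsertion p p' r, t.consBoth = s := by
  obtain ⟨⟨f, g⟩, hf, hg, hs⟩ := s
  obtain ⟨f', hf', rfl⟩ := exists_cons_of_eq_zero hf h1
  obtain ⟨g', hg', rfl⟩ := exists_cons_of_eq_zero hg h2
  refine ⟨⟨(f', g'), hf', hg', fun k => ?_⟩, rfl⟩
  rcases hs k.succ with ⟨i, hi⟩ | ⟨i, hi⟩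
  · left
    revert hi
    refine Fin.cases (fun h => ?_) (fun i h => ?_) i
    · exact absurd h.symm (Fin.succ_ne_zero k)
    · exact ⟨i, by simpa using h⟩
  · right
    revert hi
    refine Fin.cases (fun h => ?_) (fun i h => ?_) i
    · exact absurd h.symm (Fin.succ_ne_zero k)
    · exact ⟨i, by simpa using h⟩

/-- By monotonicity only first rows can reach position `0`, and some row must reach it: the left
one, the right one or both. These are the three terms of the quasi-shuffle recursion. -/
theorem bijective_cons : Function.Bijective
    (Sum.elim consLeft (Sum.elim consRight consBoth) :
      RowInsertion p (p' + 1) r ⊕ RowInsertion (p + 1) p' r ⊕ RowInsertion p p' r →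
        RowInsertion (p + 1) (p' + 1) (r + 1)) := by
  constructor
  · refine Function.Injective.sumElim consLeft_injective
      (Function.Injective.sumElim consRight_injective consBoth_injective ?_) ?_
    · intro s t h
      exact Fin.succ_ne_zero (s.1.1 0) (congrFun (congrArg (fun x => x.1.1) h) 0)
    · rintro s (t | t) h
      · exact Fin.succ_ne_zero (t.1.1 0) (congrFun (congrArg (fun x => x.1.1) h) 0).symm
      · exact Fin.succ_ne_zero (s.1.2 0) (congrFun (congrArg (fun x => x.1.2) h) 0)
  · intro s
    by_cases h1 : s.1.1 0 = 0 <;> by_cases h2 : s.1.2 0 = 0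
    · obtain ⟨t, rfl⟩ := exists_consBoth s h1 h2
      exact ⟨.inr (.inr t), rfl⟩
    · obtain ⟨t, rfl⟩ := exists_consLeft s h1 (ne_zero_of_strictMono s.2.2.1 h2)
      exact ⟨.inl t, rfl⟩
    · obtain ⟨t, rfl⟩ := exists_consRight s (ne_zero_of_strictMono s.2.1 h1) h2
      exact ⟨.inr (.inl t), rfl⟩
    · rcases s.2.2.2 0 with ⟨i, hi⟩ | ⟨i, hi⟩
      · exact absurd hi (ne_zero_of_strictMono s.2.1 h1 i)
      · exact absurd hi (ne_zero_of_strictMono s.2.2.1 h2 i)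

theorem bijective_consLeft : Function.Bijective
    (consLeft : RowInsertion p 0 r → RowInsertion (p + 1) 0 (r + 1)) := by
  refine ⟨consLeft_injective, fun s => exists_consLeft s ?_ fun i => i.elim0⟩
  by_contra h
  rcases s.2.2.2 0 with ⟨i, hi⟩ | ⟨i, hi⟩
  · exact absurd hi (ne_zero_of_strictMono s.2.1 h i)
  · exact i.elim0

theorem bijective_consRight : Function.Bijective
    (consRight : RowInsertion 0 p' r → RowInsertion 0 (p' + 1) (r + 1)) := by
  refine ⟨consRight_injective, fun s => exists_consRight s (fun i => i.elim0) ?_⟩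
  by_contra h
  rcases s.2.2.2 0 with ⟨i, hi⟩ | ⟨i, hi⟩
  · exact i.elim0
  · exact absurd hi (ne_zero_of_strictMono s.2.2.1 h i)

/-- The sums of the rows that go to the same position. -/
def merge (u : Fin p → Mon) (v : Fin p' → Mon) (s : RowInsertion p p' r) : List Mon :=
  List.ofFn fun k => (∑ i, if s.1.1 i = k then u i else 0) + ∑ i, if s.1.2 i = k then v i else 0

theorem merge_consLeft (u : Fin (p + 1) → Mon) (v : Fin p' → Mon) (s : RowInsertion p p' r) :
    merge u v s.consLeft = u 0 :: merge (fun i => u i.succ) v s := by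
  rw [merge, List.ofFn_succ, merge]
  simp [consLeft, Fin.sum_univ_succ, Fin.succ_ne_zero, (Fin.succ_ne_zero _).symm]

theorem merge_consRight (u : Fin p → Mon) (v : Fin (p' + 1) → Mon) (s : RowInsertion p p' r) :
    merge u v s.consRight = v 0 :: merge u (fun i => v i.succ) s := by
  rw [merge, List.ofFn_succ, merge]
  simp [consRight, Fin.sum_univ_succ, Fin.succ_ne_zero, (Fin.succ_ne_zero _).symm]

theorem merge_consBoth (u : Fin (p + 1) → Mon) (v : Fin (p' + 1) → Mon)
    (s : RowInsertion p p' r) : merge u v s.consBoth =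
      (u 0 + v 0) :: merge (fun i => u i.succ) (fun i => v i.succ) s := by
  rw [merge, List.ofFn_succ, merge]
  simp [consBoth, Fin.sum_univ_succ, Fin.succ_ne_zero, (Fin.succ_ne_zero _).symm]

/-- No insertion has more than `p + p'` rows, so every such `N` gives the full sum. Leaving `N` free
allows it to drop by one when the first resulting row is removed, whatever its origin. -/
theorem sum_merge (N : ℕ) {p p' : ℕ} (u : Fin p → Mon) (v : Fin p' → Mon) (hN : p + p' < N) :
    ∑ r ∈ Finset.range N, ∑ s : RowInsertion p p' r, Finsupp.single (merge u v s) (1 : K) =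
      twisted 1 1 (List.ofFn u) (List.ofFn v) := by
  induction N generalizing p p' with
  | zero => omega
  | succ N ih =>
    -- The term `r = 0` is split off; it contributes only when both families are empty.
    rw [Finset.sum_range_succ']
    rcases p with _ | p <;> rcases p' with _ | p'
    · have e : ∀ r, IsEmpty (RowInsertion 0 0 (r + 1)) := fun r => ⟨fun s => by
        rcases s.2.2.2 0 with ⟨i, -⟩ | ⟨i, -⟩ <;> exact i.elim0⟩
      let s₀ : RowInsertion 0 0 0 :=
        ⟨(Fin.elim0, Fin.elim0), fun i => i.elim0, fun i => i.elim0, fun i => i.elim0⟩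
      have hs : ∀ s, s = s₀ := fun s =>
        Subtype.ext (Prod.ext (funext fun i => i.elim0) (funext fun i => i.elim0))
      rw [Finset.sum_eq_zero fun r _ => Finset.univ_eq_empty (α := RowInsertion 0 0 (r + 1)) ▸
        Finset.sum_empty, zero_add, Fintype.sum_eq_single s₀ fun s h => absurd (hs s) h]
      simp [merge, twisted_nil_left]
    · have e : IsEmpty (RowInsertion 0 (p' + 1) 0) := ⟨fun s => (s.1.2 0).elim0⟩
      have h := ih u (fun i => v i.succ) (by omega)
      rw [Finset.univ_eq_empty, Finset.sum_empty, add_zero]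
      simp_rw [← bijective_consRight.sum_comp fun s => Finsupp.single (merge u v s) (1 : K),
        merge_consRight, ← consL_single, ← map_sum, h]
      simp [twisted_nil_left]
    · have e : IsEmpty (RowInsertion (p + 1) 0 0) := ⟨fun s => (s.1.1 0).elim0⟩
      have h := ih (fun i => u i.succ) v (by omega)
      rw [Finset.univ_eq_empty, Finset.sum_empty, add_zero]
      simp_rw [← bijective_consLeft.sum_comp fun s => Finsupp.single (merge u v s) (1 : K),
        merge_consLeft, ← consL_single, ← map_sum, h]
      simp [twisted_nil_right]
    · have e : IsEmpty (RowInsertion (p + 1) (p' + 1) 0) := ⟨fun s => (s.1.1 0).elim0⟩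
      have h1 := ih (fun i => u i.succ) v (by omega)
      have h2 := ih u (fun i => v i.succ) (by omega)
      have h3 := ih (fun i => u i.succ) (fun i => v i.succ) (by omega)
      have e' : ∀ r, ∑ s : RowInsertion (p + 1) (p' + 1) (r + 1),
          Finsupp.single (merge u v s) (1 : K) =
          consL K (u 0) (∑ s : RowInsertion p (p' + 1) r,
            Finsupp.single (merge (fun i => u i.succ) v s) 1) +
          (consL K (v 0) (∑ s : RowInsertion (p + 1) p' r,
            Finsupp.single (merge u (fun i => v i.succ) s) 1) +
          consL K (u 0 + v 0) (∑ s : RowInsertion p p' r,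
            Finsupp.single (merge (fun i => u i.succ) (fun i => v i.succ) s) 1)) := by
        intro r
        rw [← bijective_cons.sum_comp, Fintype.sum_sum_type, Fintype.sum_sum_type]
        simp only [Sum.elim_inl, Sum.elim_inr, merge_consLeft, merge_consRight, merge_consBoth,
          map_sum, consL_single]
      rw [Finset.univ_eq_empty, Finset.sum_empty, add_zero, Finset.sum_congr rfl fun r _ => e' r,
        Finset.sum_add_distrib, Finset.sum_add_distrib, ← map_sum, ← map_sum, ← map_sum, h1, h2,
        h3, List.ofFn_succ, List.ofFn_succ, twisted_cons_cons]
      simp [add_assoc]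

end RowInsertion

theorem code_augment (P Q : LDiag) {r : ℕ} (s : RowInsertion P.p Q.p r) :
    (P.augment Q s).code = RowInsertion.merge
      (fun i => ∑ j : Fin P.q, Finsupp.single (j : ℕ) (P.m i j))
      (fun i => ∑ j : Fin Q.q, Finsupp.single (j + P.q : ℕ) (Q.m i j)) s := by
  let m : Fin r → Fin (P.q + Q.q) → ℕ :=
    fun k => Fin.addCases (fun j => ∑ i, if s.1.1 i = k then P.m i j else 0)
      (fun j => ∑ i, if s.1.2 i = k then Q.m i j else 0)
  have h : (P.augment Q s).code = List.ofFn fun k =>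
    ∑ j : Fin (P.q + Q.q), Finsupp.single (j : ℕ) (m k j) := rfl
  rw [h, RowInsertion.merge]
  congr 1
  funext k
  rw [Fin.sum_univ_add]
  have hsum : ∀ {n : ℕ} (a : ℕ) (f : Fin n → ℕ),
      Finsupp.single a (∑ i, f i) = ∑ i, Finsupp.single a (f i) := fun a f =>
    map_sum (Finsupp.singleAddHom a) f _
  simp only [m, Fin.addCases_left, Fin.addCases_right, hsum]
  congr 1
  · rw [Finset.sum_comm]
    refine Finset.sum_congr rfl fun i _ => ?_
    split_ifs <;> simp
  · rw [Finset.sum_comm]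
    refine Finset.sum_congr rfl fun i _ => ?_
    split_ifs <;> simp [add_comm]

theorem mqsym_mul : (mqsym K).mul = deformedMul 1 1 := by
  refine bilin_ext fun P Q => codeL_injective ?_
  rw [codeL_deformedMul_single, mqsym, bilin_single]
  simp only [map_sum, codeL_single, code_augment]
  rw [RowInsertion.sum_merge _ _ _ (Nat.lt_succ_self _), translate, LDiag.code, LDiag.code,
    List.map_ofFn]
  congr 2
  funext i
  simp [Finsupp.mapDomain_finsetSum, Finsupp.mapDomain_single]

theorem ldiagOf_mul (c : Colour) : (ldiagOf K c).mul = deformedMul 0 0 := by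
  refine bilin_ext fun d e => codeL_injective ?_
  rw [codeL_deformedMul_single, ldiagOf, bilin_single, codeL_single, LDiag.code_concat,
    translate_eq_relabel,
    twisted_zero_zero d.zero_notMem_code (zero_notMem_relabel e.zero_notMem_code)]

/-! ### Restrictions of diagrams and sublists of codes -/

/-- Deletion of the unit monomials of a list. -/
def dropUnits (l : List Mon) : List Mon := l.filter fun a => a ≠ 0

theorem dropUnits_cons_zero (l : List Mon) : dropUnits (0 :: l) = dropUnits l := by
  simp [dropUnits]

theorem dropUnits_cons_of_ne_zero {a : Mon} (ha : a ≠ 0) (l : List Mon) :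
    dropUnits (a :: l) = a :: dropUnits l := by
  simp [dropUnits, ha]

theorem zero_notMem_dropUnits (l : List Mon) : 0 ∉ dropUnits l := by
  simp [dropUnits]

/-- Both lists enumerate the same finite set in increasing order. -/
theorem ofFn_orderEmbOfFin {n : ℕ} (P : Fin n → Prop) [DecidablePred P] :
    List.ofFn (fun i => (Finset.univ.filter P).orderEmbOfFin rfl i) =
      (List.finRange n).filter fun i => P i := by
  have h : ((List.finRange n).filter fun i => P i).toFinset = Finset.univ.filter P := by
    ext i; simp
  have hn : ((List.finRange n).filter fun i => P i).Nodup := (List.nodup_finRange n).filter _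
  rw [List.ofFn_eq_map, Finset.listMap_orderEmbOfFin_finRange, ← h,
    (List.toFinset_sort (· ≤ ·) hn).2 ((List.pairwise_le_finRange n).filter _)]

theorem sum_single_ne_zero_iff {q : ℕ} (f : Fin q → ℕ) :
    (∑ j : Fin q, Finsupp.single (j : ℕ) (f j)) ≠ 0 ↔ ∃ j, f j ≠ 0 := by
  have h : ∀ j, (∑ j : Fin q, Finsupp.single (j : ℕ) (f j)) (j : Fin q) = f j := by
    intro j
    rw [Finsupp.finsetSum_apply, Finset.sum_eq_single j]
    · simp
    · intro b _ hb
      rw [Finsupp.single_apply, if_neg fun e => hb (Fin.ext e)]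
    · simp
  constructor
  · contrapose!
    intro hf
    simp [hf]
  · rintro ⟨j, hj⟩ h0
    have := h j
    rw [h0] at this
    exact hj this.symm

/-- Sending `k` to the `k`-th nonzero column undoes the packing of columns and recovers the original
nonzero rows. This map is increasing, so `std` does not see it. -/
theorem code_pack {p q : ℕ} (m : Fin p → Fin q → ℕ) :
    (LDiag.pack m).code = std (dropUnits (List.ofFn fun i =>
      ∑ j : Fin q, Finsupp.single (j : ℕ) (m i j))) := by
  classical
  let T := Finset.univ.filter fun j : Fin q => ∃ i, m i j ≠ 0
  let f : ℕ → ℕ := fun k => if h : k < T.card then T.orderEmbOfFin rfl ⟨k, h⟩ else 0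
  have hf : StrictMonoOn f (used (LDiag.pack m).code) := by
    have hT : (LDiag.pack m).q = T.card := by
      simp only [LDiag.pack, T]
    rw [LDiag.used_code, hT]
    intro a ha b hb hab
    have ha' : a < T.card := Finset.mem_range.1 ha
    have hb' : b < T.card := Finset.mem_range.1 hb
    simp only [f, dif_pos ha', dif_pos hb']
    exact (T.orderEmbOfFin rfl).strictMono (show (⟨a, ha'⟩ : Fin T.card) < ⟨b, hb'⟩ from hab)
  have hrow : ∀ i, Finsupp.mapDomain f (∑ j : Fin T.card,
      Finsupp.single (j : ℕ) (m i (T.orderEmbOfFin rfl j))) =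
      ∑ j : Fin q, Finsupp.single (j : ℕ) (m i j) := by
    intro i
    rw [Finsupp.mapDomain_finsetSum]
    have e : ∀ j : Fin T.card, Finsupp.mapDomain f
        (Finsupp.single (j : ℕ) (m i (T.orderEmbOfFin rfl j))) =
        Finsupp.single (T.orderEmbOfFin rfl j : ℕ) (m i (T.orderEmbOfFin rfl j)) := by
      intro j
      rw [Finsupp.mapDomain_single]
      simp [f]
    rw [Finset.sum_congr rfl fun j _ => e j]
    have := Finset.sum_map Finset.univ (T.orderEmbOfFin rfl).toEmbedding
      fun j => Finsupp.single (j : ℕ) (m i j)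
    rw [Finset.map_orderEmbOfFin_univ] at this
    refine this.symm.trans (Finset.sum_subset (Finset.subset_univ _) fun j _ hj => ?_)
    have : m i j = 0 := by
      by_contra h
      exact hj (Finset.mem_filter.2 ⟨Finset.mem_univ _, i, h⟩)
    rw [this, Finsupp.single_zero]
  have key : relabel f (LDiag.pack m).code = dropUnits (List.ofFn fun i =>
      ∑ j : Fin q, Finsupp.single (j : ℕ) (m i j)) := by
    have h1 : relabel f (LDiag.pack m).code =
        List.ofFn fun i : Fin (Finset.univ.filter fun i : Fin p => ∃ j, m i j ≠ 0).card =>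
          ∑ j : Fin q, Finsupp.single (j : ℕ)
            (m ((Finset.univ.filter fun i : Fin p => ∃ j, m i j ≠ 0).orderEmbOfFin rfl i) j) := by
      simp_rw [← hrow]
      rw [relabel, LDiag.code, List.map_ofFn, LDiag.pack]
      simp only [T, Function.comp_def]
    rw [h1]
    have h2 := ofFn_orderEmbOfFin fun i : Fin p => ∃ j, m i j ≠ 0
    have h3 := congrArg (List.map fun i => ∑ j : Fin q, Finsupp.single (j : ℕ) (m i j)) h2
    rw [List.map_ofFn] at h3
    refine h3.trans ?_
    rw [dropUnits, List.ofFn_eq_map, List.filter_map]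
    congr 1
    refine List.filter_congr fun i _ => ?_
    simp only [Function.comp_apply, decide_eq_decide]
    exact (sum_single_ne_zero_iff _).symm
  rw [← key, std_relabel hf, std_of_used_eq_range (LDiag.used_code _)]

theorem code_restrictBlack (d : LDiag) (I : Finset (Fin d.p)) :
    (d.restrictBlack I).code = std (dropUnits (List.ofFn fun i =>
      if i ∈ I then ∑ j : Fin d.q, Finsupp.single (j : ℕ) (d.m i j) else 0)) := by
  rw [LDiag.restrictBlack, code_pack]
  congr 3
  funext i
  split_ifs <;> simp

theorem restrictBlack_eq_packList (d : LDiag) (I : Finset (Fin d.p)) :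
    d.restrictBlack I = packList (dropUnits (List.ofFn fun i =>
      if i ∈ I then ∑ j : Fin d.q, Finsupp.single (j : ℕ) (d.m i j) else 0)) :=
  LDiag.code_injective <| by
    rw [code_restrictBlack, code_packList (zero_notMem_dropUnits _)]

theorem dropUnits_ofFn {n : ℕ} {r : Fin n → Mon} (hr : ∀ i, r i ≠ 0) :
    dropUnits (List.ofFn r) = List.ofFn r := by
  rw [dropUnits, List.filter_eq_self]
  intro a ha
  obtain ⟨i, rfl⟩ := List.mem_ofFn.1 ha
  simpa using hr i

theorem dropUnits_ofFn_zero (n : ℕ) : dropUnits (List.ofFn fun _ : Fin n => 0) = [] := by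
  rw [dropUnits, List.filter_eq_nil_iff]
  intro a ha
  obtain ⟨i, rfl⟩ := List.mem_ofFn.1 ha
  simp

/-- The cut at `0` has an empty upper part; the cut at `t + 1` adds the first row to the upper part
of the cut at `t` of the other rows. This is the recursion of `cut`. -/
theorem sum_cut {M : Type*} [AddCommMonoid M] {n : ℕ} {r : Fin n → Mon} (hr : ∀ i, r i ≠ 0)
    (G : List Mon → List Mon → M) :
    ∑ t ∈ Finset.range (n + 1),
        G (dropUnits (List.ofFn fun i : Fin n => if (i : ℕ) < t then r i else 0))
          (dropUnits (List.ofFn fun i : Fin n => if t ≤ (i : ℕ) then r i else 0)) =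
      ((cut (List.ofFn r)).map fun p => G p.1 p.2).sum := by
  induction n generalizing G with
  | zero => simp [cut, dropUnits]
  | succ n ih =>
    have := ih (r := fun i => r i.succ) (fun i => hr i.succ) fun x y => G (r 0 :: x) y
    have h1 := dropUnits_ofFn hr
    have hc : cut (List.ofFn r) = ([], List.ofFn r) ::
        (cut (List.ofFn fun i => r i.succ)).map (Prod.map (List.cons (r 0)) id) := by
      rw [List.ofFn_succ, cut]
    rw [Finset.sum_range_succ', hc, List.map_cons, List.sum_cons, add_comm,
      List.map_map]
    congr 1
    · simp only [Nat.not_lt_zero, if_false, Nat.zero_le, if_true, h1, dropUnits_ofFn_zero]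
    · simp only [Function.comp_def, Prod.map_fst, Prod.map_snd, id_eq]
      rw [← this]
      refine Finset.sum_congr rfl fun t _ => ?_
      simp [List.ofFn_succ, dropUnits_cons_of_ne_zero (hr 0), dropUnits_cons_zero]

/-- A subset of `Fin (n + 1)` is given by a subset of `Fin n` and by whether it contains `0`. -/
def finsetFinSucc (n : ℕ) : Bool × Finset (Fin n) ≃ Finset (Fin (n + 1)) where
  toFun x := Finset.univ.filter fun i => (Fin.cons x.1 (fun j => decide (j ∈ x.2)) :
    Fin (n + 1) → Bool) i = true
  invFun I := (decide (0 ∈ I), Finset.univ.filter fun j => j.succ ∈ I)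
  left_inv x := by
    ext <;> simp
  right_inv I := by
    ext i
    refine Fin.cases ?_ (fun i => ?_) i <;> simp

/-- Whether `0 ∈ I` decides which part receives the first row, as in the recursion of `unshuffle`.
-/
theorem sum_unshuffle {M : Type*} [AddCommMonoid M] {n : ℕ} {r : Fin n → Mon}
    (hr : ∀ i, r i ≠ 0) (G : List Mon → List Mon → M) :
    ∑ I : Finset (Fin n), G (dropUnits (List.ofFn fun i => if i ∈ I then r i else 0))
          (dropUnits (List.ofFn fun i => if i ∈ Iᶜ then r i else 0)) =
      ((unshuffle (List.ofFn r)).map fun p => G p.1 p.2).sum := by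
  induction n generalizing G with
  | zero => simp [unshuffle, dropUnits]
  | succ n ih =>
    have h1 := ih (r := fun i => r i.succ) (fun i => hr i.succ) fun x y => G (r 0 :: x) y
    have h2 := ih (r := fun i => r i.succ) (fun i => hr i.succ) fun x y => G x (r 0 :: y)
    rw [← (finsetFinSucc n).sum_comp, Fintype.sum_prod_type, Fintype.sum_bool, List.ofFn_succ,
      unshuffle, List.map_append, List.sum_append, List.map_map, List.map_map]
    simp only [Function.comp_def, Prod.map_fst, Prod.map_snd, id_eq]
    rw [← h1, ← h2]
    congr 1
    all_goals
      refine Finset.sum_congr rfl fun t _ => ?_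
      simp [List.ofFn_succ, dropUnits_cons_of_ne_zero (hr 0), dropUnits_cons_zero, finsetFinSucc]

theorem row_ne_zero (d : LDiag) (i : Fin d.p) :
    (∑ j : Fin d.q, Finsupp.single (j : ℕ) (d.m i j)) ≠ 0 :=
  (sum_single_ne_zero_iff _).2 (d.row_ne i)

theorem ldiag_comul : (ldiag K).comul = packComul K unshuffle := by
  refine Finsupp.lhom_ext' fun d => LinearMap.ext_ring ?_
  simp only [LinearMap.comp_apply, Finsupp.lsingle_apply, packComul_single, ldiag, ldiagOf,
    Finsupp.linearCombination_single, one_smul, spotComul, restrictBlack_eq_packList]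
  exact sum_unshuffle (row_ne_zero d) fun x y =>
    Finsupp.single (packList x) (1 : K) ⊗ₜ[K] Finsupp.single (packList y) (1 : K)

theorem mqsym_comul : (mqsym K).comul = packComul K cut := by
  refine Finsupp.lhom_ext' fun d => LinearMap.ext_ring ?_
  simp only [LinearMap.comp_apply, Finsupp.lsingle_apply, packComul_single, mqsym,
    Finsupp.linearCombination_single, one_smul, restrictBlack_eq_packList, Finset.mem_filter,
    Finset.mem_univ, true_and]
  exact sum_cut (row_ne_zero d) fun x y =>
    Finsupp.single (packList x) (1 : K) ⊗ₜ[K] Finsupp.single (packList y) (1 : K)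

theorem mqsym_isConnectedBialgebra {K : Type u} [CommRing K] :
    (mqsym K).IsConnectedBialgebra :=
  isConnectedBialgebra_of_isSplitting isSplitting_cut isMultiplicative_cut mqsym_mul rfl
    mqsym_comul rfl

theorem ldiag_isConnectedBialgebra {K : Type u} [CommRing K] :
    (ldiag K).IsConnectedBialgebra :=
  isConnectedBialgebra_of_isSplitting isSplitting_unshuffle isMultiplicative_unshuffle
    (ldiagOf_mul _) rfl ldiag_comul rfl

/-! ### Transposition -/

/-- Exchange of the black and white spots. -/
def LDiag.transpose (d : LDiag) : LDiag where
  p := d.q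
  q := d.p
  m j i := d.m i j
  row_ne := d.col_ne
  col_ne := d.row_ne

theorem LDiag.transpose_concat (d e : LDiag) :
    (d.concat e).transpose = d.transpose.concat e.transpose := by
  have h : (d.concat e).transpose.m = (d.transpose.concat e.transpose).m := by
    funext j i
    refine Fin.addCases (fun j => ?_) (fun j => ?_) j <;>
      refine Fin.addCases (fun i => ?_) (fun i => ?_) i <;>
      simp [LDiag.transpose, LDiag.concat]
  exact LDiag.ext rfl rfl (heq_of_eq h)

theorem LDiag.transpose_empty : LDiag.empty.transpose = LDiag.empty := LDiag.p_eq_zero.1 rfl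

theorem LDiag.transpose_restrictWhite (d : LDiag) (J : Finset (Fin d.q)) :
    (d.restrictWhite J).transpose = d.transpose.restrictBlack J := rfl

/-- Transposition as a bijection. -/
def transposeEquiv : LDiag ≃ LDiag :=
  ⟨LDiag.transpose, LDiag.transpose, fun _ => rfl, fun _ => rfl⟩

/-- Transposition respects concatenation and exchanges the two kinds of restriction, since packing
treats rows and columns alike. -/
theorem ldiagOf_isIsomorphic (c : Colour) : (ldiagOf K c).IsIsomorphic (ldiag K) := by
  cases c with
  | black => exact ⟨LinearEquiv.refl K _, fun _ _ => rfl, rfl, fun x => by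
      rw [LinearEquiv.refl_toLinearMap, TensorProduct.map_id]; rfl, fun _ => rfl⟩
  | white =>
    let e : (LDiag →₀ K) ≃ₗ[K] (LDiag →₀ K) := Finsupp.domLCongr transposeEquiv
    have he : ∀ d, e (Finsupp.single d 1) = Finsupp.single d.transpose 1 := fun d =>
      Finsupp.domLCongr_single _ _ _
    refine ⟨e, fun x y => ?_, (he _).trans (by rw [LDiag.transpose_empty]; rfl),
      fun x => ?_, fun x => ?_⟩
    · have : (ldiagOf K .white).mul.compr₂ e.toLinearMap =
          (ldiag K).mul.compl₁₂ e.toLinearMap e.toLinearMap := by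
        refine bilin_ext fun d f => ?_
        simp only [LinearMap.compr₂_apply, LinearMap.compl₁₂_apply, LinearEquiv.coe_coe, he, ldiag,
          ldiagOf, bilin_single, LDiag.transpose_concat]
      exact LinearMap.congr_fun₂ this x y
    · have : (ldiag K).comul ∘ₗ e.toLinearMap =
          TensorProduct.map e.toLinearMap e.toLinearMap ∘ₗ (ldiagOf K .white).comul := by
        refine Finsupp.lhom_ext' fun d => LinearMap.ext_ring ?_
        simp only [LinearMap.comp_apply, Finsupp.lsingle_apply, LinearEquiv.coe_coe, he, ldiag,
          ldiagOf, Finsupp.linearCombination_single, one_smul, spotComul, map_sum,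
          TensorProduct.map_tmul, LDiag.transpose_restrictWhite]
        rfl
      exact LinearMap.congr_fun this x
    · have : (ldiag K).counit ∘ₗ e.toLinearMap = (ldiagOf K .white).counit := by
        classical
        refine Finsupp.lhom_ext' fun d => LinearMap.ext_ring ?_
        simp only [LinearMap.comp_apply, Finsupp.lsingle_apply, LinearEquiv.coe_coe, he, ldiag,
          ldiagOf, constTerm_single]
        refine if_congr ?_ rfl rfl
        have := transposeEquiv.apply_eq_iff_eq (x := d) (y := LDiag.empty)
        rwa [show transposeEquiv LDiag.empty = LDiag.empty from LDiag.transpose_empty] at this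
      exact LinearMap.congr_fun this x

/-! ### Transport of coproducts between the deformed algebras -/

/-- The comultiplication is a morphism of unital algebras. -/
structure HopfOps.ComulIsAlgHom (A : HopfOps K) : Prop where
  comul_one : A.comul A.one = A.one ⊗ₜ[K] A.one
  comul_mul : ∀ x y, A.comul (A.mul x y) = TensorProduct.map₂ A.mul A.mul (A.comul x) (A.comul y)

theorem map₂_map {A B : HopfOps K} {f : (LDiag →₀ K) →ₗ[K] (LDiag →₀ K)}
    (hf : ∀ x y, f (A.mul x y) = B.mul (f x) (f y)) (s t : (LDiag →₀ K) ⊗[K] (LDiag →₀ K)) :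
    TensorProduct.map f f (TensorProduct.map₂ A.mul A.mul s t) =
      TensorProduct.map₂ B.mul B.mul (TensorProduct.map f f s) (TensorProduct.map f f t) := by
  induction s with
  | zero => simp
  | add s s' h h' => simp only [map_add, LinearMap.add_apply, h, h']
  | tmul x x' =>
    induction t with
    | zero => simp
    | add s s' h h' => simp only [map_add, h, h']
    | tmul y y' => simp [hf]

/-- The identities are checked after applying the injective map `e ⊗ e`. This spares a direct
treatment of the white-spot coproduct. -/
theorem HopfOps.ComulIsAlgHom.of_isIsomorphic {A B : HopfOps K} (hB : B.ComulIsAlgHom)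
    (h : A.IsIsomorphic B) : A.ComulIsAlgHom := by
  obtain ⟨e, h1, h2, h3, -⟩ := h
  have hinj : Function.Injective (TensorProduct.map e.toLinearMap e.toLinearMap) :=
    (TensorProduct.congr e e).injective
  constructor
  · apply hinj
    rw [← h3, h2, hB.comul_one]
    simp [h2]
  · intro x y
    apply hinj
    rw [← h3, h1, hB.comul_mul, h3, h3, map₂_map (B := B) h1]

theorem comulIsAlgHom_ldiagOf (c : Colour) : (ldiagOf K c).ComulIsAlgHom :=
  .of_isIsomorphic ⟨ldiag_isConnectedBialgebra.comul_one, ldiag_isConnectedBialgebra.comul_mul⟩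
    (ldiagOf_isIsomorphic c)

theorem comulIsAlgHom_mqsym : (mqsym K).ComulIsAlgHom :=
  ⟨mqsym_isConnectedBialgebra.comul_one, mqsym_isConnectedBialgebra.comul_mul⟩

/-- The algebra underlying `A` is one of the deformed algebras of diagrams. -/
structure HopfOps.IsDeformedAlgebra (A : HopfOps K) (qc qs : K) : Prop where
  mul_eq : A.mul = deformedMul qc qs
  one_eq : A.one = Finsupp.single LDiag.empty 1
  counit_eq : A.counit = constTerm

theorem isDeformedAlgebra_ldiagDeformed (qc qs : K)
    (Δ : (LDiag →₀ K) →ₗ[K] (LDiag →₀ K) ⊗[K] (LDiag →₀ K)) :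
    (ldiagDeformed qc qs Δ).IsDeformedAlgebra qc qs := ⟨rfl, rfl, rfl⟩

namespace HopfOps.IsDeformedAlgebra

variable {A B : HopfOps K} {qc qs qc' qs' : K} (hA : A.IsDeformedAlgebra qc qs)
  (hB : B.IsDeformedAlgebra qc' qs')

include hA in
theorem wordProd_append (v w : List Irr) :
    A.wordProd (Finsupp.single (v ++ w) 1) =
      A.mul (A.wordProd (Finsupp.single v 1)) (A.wordProd (Finsupp.single w 1)) := by
  induction v with
  | nil =>
    rw [List.nil_append, wordProd_single A [], List.foldr_nil, hA.one_eq, hA.mul_eq,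
      deformedMul_one_left]
  | cons d v ih =>
    rw [List.cons_append, wordProd_cons, ih, wordProd_cons, hA.mul_eq, deformedMul_assoc]

include hA in
theorem wordProd_singleton (d : Irr) :
    A.wordProd (Finsupp.single [d] 1) = Finsupp.single d.1 1 := by
  rw [wordProd_cons, wordProd_single, List.foldr_nil, hA.mul_eq, hA.one_eq, deformedMul_one_right]

include hA in
theorem counit_wordProd (w : List Irr) [Decidable (w = [])] :
    A.counit (A.wordProd (Finsupp.single w 1)) = if w = [] then 1 else 0 := by
  classical
  cases w with
  | nil => simp [wordProd_single, hA.one_eq, hA.counit_eq, constTerm_single]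
  | cons d w =>
    rw [wordProd_cons, hA.mul_eq, hA.counit_eq, constTerm_deformedMul, constTerm_single,
      if_neg d.2.1, zero_mul, if_neg (List.cons_ne_nil _ _)]

/-- The module isomorphism with the free algebra on the irreducible diagrams. -/
def wordEquiv : (List Irr →₀ K) ≃ₗ[K] (LDiag →₀ K) :=
  LinearEquiv.ofBijective A.wordProd (wordProd_bijective hA.mul_eq hA.one_eq)

theorem wordEquiv_apply (x : List Irr →₀ K) : hA.wordEquiv x = A.wordProd x := rfl

/-- The isomorphism of algebras that is the identity on irreducible diagrams. -/
def comparison : (LDiag →₀ K) ≃ₗ[K] (LDiag →₀ K) := hB.wordEquiv.symm.trans hA.wordEquiv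

theorem comparison_wordProd (x : List Irr →₀ K) :
    hA.comparison hB (B.wordProd x) = A.wordProd x := by
  rw [← hB.wordEquiv_apply, comparison, LinearEquiv.trans_apply, LinearEquiv.symm_apply_apply,
    wordEquiv_apply]

theorem comparison_single (d : Irr) :
    hA.comparison hB (Finsupp.single d.1 1) = Finsupp.single d.1 1 := by
  have := hA.comparison_wordProd hB (Finsupp.single [d] 1)
  rwa [hB.wordProd_singleton, hA.wordProd_singleton] at this

theorem comparison_one : hA.comparison hB B.one = A.one := by
  have h : ∀ C : HopfOps K, C.one = C.wordProd (Finsupp.single [] 1) := fun C => by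
    rw [wordProd_single, List.foldr_nil]
  rw [h B, comparison_wordProd, ← h A]

include hB in
/-- Linear maps on a deformed algebra that agree on products of irreducible diagrams are equal. -/
theorem hom_ext {M : Type*} [AddCommMonoid M] [Module K M] {f g : (LDiag →₀ K) →ₗ[K] M}
    (h : ∀ w, f (B.wordProd (Finsupp.single w 1)) = g (B.wordProd (Finsupp.single w 1))) :
    f = g := by
  have : f ∘ₗ B.wordProd = g ∘ₗ B.wordProd :=
    Finsupp.lhom_ext' fun w => LinearMap.ext_ring (h w)
  refine LinearMap.ext fun x => ?_
  obtain ⟨y, rfl⟩ := hB.wordEquiv.surjective x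
  exact LinearMap.congr_fun this y

theorem comparison_mul (x y : LDiag →₀ K) :
    hA.comparison hB (B.mul x y) = A.mul (hA.comparison hB x) (hA.comparison hB y) := by
  have : B.mul.compr₂ (hA.comparison hB).toLinearMap =
      A.mul.compl₁₂ (hA.comparison hB).toLinearMap (hA.comparison hB).toLinearMap := by
    refine hB.hom_ext fun v => hB.hom_ext fun w => ?_
    simp only [LinearMap.compr₂_apply, LinearMap.compl₁₂_apply, LinearEquiv.coe_coe,
      comparison_wordProd, ← hA.wordProd_append, ← hB.wordProd_append]
  exact LinearMap.congr_fun₂ this x y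

theorem counit_comparison (x : LDiag →₀ K) : A.counit (hA.comparison hB x) = B.counit x := by
  classical
  have : A.counit ∘ₗ (hA.comparison hB).toLinearMap = B.counit := by
    refine hB.hom_ext fun w => ?_
    simp only [LinearMap.comp_apply, LinearEquiv.coe_coe, comparison_wordProd, hA.counit_wordProd,
      hB.counit_wordProd]
  exact LinearMap.congr_fun this x

-- The square of the surjection from the free algebra is surjective, so structure constants exist
-- for any coproduct on `A`.
include hA in
theorem exists_isExpansion (d : Irr) : ∃ t, A.IsExpansion d t :=
  TensorProduct.map_surjective hA.wordEquiv.surjective hA.wordEquiv.surjective _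

/-- The coproduct of `B` transported along the comparison map. -/
def transportComul : (LDiag →₀ K) →ₗ[K] (LDiag →₀ K) ⊗[K] (LDiag →₀ K) :=
  TensorProduct.map (hA.comparison hB).toLinearMap (hA.comparison hB).toLinearMap ∘ₗ
    B.comul ∘ₗ (hA.comparison hB).symm.toLinearMap

theorem transportComul_comparison (x : LDiag →₀ K) :
    hA.transportComul hB (hA.comparison hB x) = TensorProduct.map (hA.comparison hB).toLinearMap
      (hA.comparison hB).toLinearMap (B.comul x) := by
  simp [transportComul]

theorem map_comparison_wordProd (t : (List Irr →₀ K) ⊗[K] (List Irr →₀ K)) :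
    TensorProduct.map (hA.comparison hB).toLinearMap (hA.comparison hB).toLinearMap
      (TensorProduct.map B.wordProd B.wordProd t) = TensorProduct.map A.wordProd A.wordProd t := by
  have : (hA.comparison hB).toLinearMap ∘ₗ B.wordProd = A.wordProd :=
    LinearMap.ext (hA.comparison_wordProd hB)
  rw [← LinearMap.comp_apply, ← TensorProduct.map_comp, this]

theorem transportComul_one (hΔ : B.ComulIsAlgHom) :
    hA.transportComul hB A.one = A.one ⊗ₜ[K] A.one := by
  rw [← hA.comparison_one hB, transportComul_comparison, hΔ.comul_one, TensorProduct.map_tmul]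
  rfl

theorem transportComul_mul (hΔ : B.ComulIsAlgHom) (x y : LDiag →₀ K) :
    hA.transportComul hB (A.mul x y) = TensorProduct.map₂ A.mul A.mul
      (hA.transportComul hB x) (hA.transportComul hB y) := by
  obtain ⟨x, rfl⟩ := (hA.comparison hB).surjective x
  obtain ⟨y, rfl⟩ := (hA.comparison hB).surjective y
  rw [← hA.comparison_mul hB, transportComul_comparison, transportComul_comparison,
    transportComul_comparison, hΔ.comul_mul, map₂_map (B := A) (hA.comparison_mul hB)]

/-- The comparison map fixes irreducible diagrams and turns a word evaluated in `B` into the same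
word evaluated in `A`. The transported coproduct thus has, on generators, the structure constants of
`B`. -/
theorem transportComul_single {d : Irr} {t : (List Irr →₀ K) ⊗[K] (List Irr →₀ K)}
    (ht : B.IsExpansion d t) : hA.transportComul hB (Finsupp.single d.1 1) =
      TensorProduct.map A.wordProd A.wordProd t := by
  rw [← hA.comparison_single hB, transportComul_comparison, ← ht, map_comparison_wordProd]

/-- An algebra morphism given on the irreducible diagrams by the structure constants of `B` is
the transported coproduct. -/
theorem eq_transportComul (hΔ : B.ComulIsAlgHom) (hΔ' : A.ComulIsAlgHom)
    (h : ∀ d : Irr, ∃ t, B.IsExpansion d t ∧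
      A.comul (Finsupp.single d.1 1) = TensorProduct.map A.wordProd A.wordProd t) :
    A.comul = hA.transportComul hB := by
  refine hA.hom_ext fun w => ?_
  induction w with
  | nil =>
    rw [wordProd_single, List.foldr_nil, hΔ'.comul_one, hA.transportComul_one hB hΔ]
  | cons d w ih =>
    obtain ⟨t, ht, hd⟩ := h d
    rw [wordProd_cons, hΔ'.comul_mul, ih, hA.transportComul_mul hB hΔ, hd,
      hA.transportComul_single hB ht]

theorem isIsomorphic_of_comul_eq (h : A.comul = hA.transportComul hB) : B.IsIsomorphic A :=
  ⟨hA.comparison hB, hA.comparison_mul hB, hA.comparison_one hB,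
    fun x => by rw [h, transportComul_comparison], hA.counit_comparison hB⟩

end HopfOps.IsDeformedAlgebra

theorem HopfOps.IsIsomorphic.symm {A B : HopfOps K} (h : A.IsIsomorphic B) :
    B.IsIsomorphic A := by
  obtain ⟨e, h1, h2, h3, h4⟩ := h
  refine ⟨e.symm, fun x y => ?_, ?_, fun x => ?_, fun x => ?_⟩
  · rw [LinearEquiv.symm_apply_eq, h1]
    simp
  · rw [LinearEquiv.symm_apply_eq, h2]
  · have := h3 (e.symm x)
    rw [LinearEquiv.apply_symm_apply] at this
    rw [this, ← LinearMap.comp_apply, ← TensorProduct.map_comp]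
    simp
  · rw [← h4, LinearEquiv.apply_symm_apply]

/-! ### The coproducts of the deformed algebras -/

theorem isDeformedAlgebra_ldiagOf (c : Colour) : (ldiagOf K c).IsDeformedAlgebra 0 0 :=
  ⟨ldiagOf_mul c, rfl, rfl⟩

theorem isDeformedAlgebra_mqsym : (mqsym K).IsDeformedAlgebra 1 1 := ⟨mqsym_mul, rfl, rfl⟩

theorem IsDeformedComul.comulIsAlgHom {c : Colour} {qc qs qt : K}
    {Δ : (LDiag →₀ K) →ₗ[K] (LDiag →₀ K) ⊗[K] (LDiag →₀ K)}
    (h : IsDeformedComul c qc qs qt Δ) : (ldiagDeformed qc qs Δ).ComulIsAlgHom :=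
  ⟨h.map_one, h.map_mul⟩

/-- The reference structure whose coproduct is deformed is `B`: on each irreducible diagram, the
interpolated structure constants are those of `B`. -/
def IsReference (c : Colour) (qt : K) (B : HopfOps K) : Prop :=
  ∀ (d : Irr) (t₀ t₁ : (List Irr →₀ K) ⊗[K] (List Irr →₀ K)),
    (ldiagOf K c).IsExpansion d t₀ → (mqsym K).IsExpansion d t₁ →
      B.IsExpansion d ((1 - qt) • t₀ + qt • t₁)

theorem isReference_ldiagOf (c : Colour) : IsReference c (0 : K) (ldiagOf K c) :=
  fun d t₀ t₁ h₀ _ => by simpa using h₀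

theorem isReference_mqsym (c : Colour) : IsReference c (1 : K) (mqsym K) :=
  fun d t₀ t₁ _ h₁ => by simpa using h₁

section

variable {c : Colour} {qt qc' qs' : K} {B : HopfOps K} (hB : B.IsDeformedAlgebra qc' qs')
  (hΔ : B.ComulIsAlgHom) (hR : IsReference c qt B) (qc qs : K)

include hΔ hR in
theorem isDeformedComul_transportComul :
    IsDeformedComul c qc qs qt ((isDeformedAlgebra_ldiagDeformed qc qs 0).transportComul hB) where
  map_one := (isDeformedAlgebra_ldiagDeformed qc qs 0).transportComul_one hB hΔ
  map_mul := (isDeformedAlgebra_ldiagDeformed qc qs 0).transportComul_mul hB hΔ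
  map_irr d := by
    obtain ⟨t₀, h₀⟩ := (isDeformedAlgebra_ldiagOf (K := K) c).exists_isExpansion d
    obtain ⟨t₁, h₁⟩ := (isDeformedAlgebra_mqsym (K := K)).exists_isExpansion d
    exact ⟨t₀, t₁, h₀, h₁, (isDeformedAlgebra_ldiagDeformed qc qs 0).transportComul_single hB
      (hR d t₀ t₁ h₀ h₁)⟩

variable {qc qs} {Δ : (LDiag →₀ K) →ₗ[K] (LDiag →₀ K) ⊗[K] (LDiag →₀ K)}
  (h : IsDeformedComul c qc qs qt Δ)

include hΔ hR h in
theorem IsDeformedComul.eq_transportComul :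
    Δ = (isDeformedAlgebra_ldiagDeformed qc qs Δ).transportComul hB := by
  refine (isDeformedAlgebra_ldiagDeformed qc qs Δ).eq_transportComul hB hΔ h.comulIsAlgHom
    fun d => ?_
  obtain ⟨t₀, t₁, h₀, h₁, hd⟩ := h.map_irr d
  exact ⟨_, hR d t₀ t₁ h₀ h₁, hd⟩

-- The parameters `qc`, `qs` are unrelated to those of `B`: the isomorphism type depends on `q_t`
-- and the colour alone.
include hB hΔ hR h in
theorem IsDeformedComul.isIsomorphic : (ldiagDeformed qc qs Δ).IsIsomorphic B :=
  .symm ((isDeformedAlgebra_ldiagDeformed qc qs Δ).isIsomorphic_of_comul_eq hB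
    (h.eq_transportComul hB hΔ hR))

include hB hΔ hR in
theorem existsUnique_isDeformedComul : ∃! Δ, IsDeformedComul c qc qs qt Δ :=
  ⟨_, isDeformedComul_transportComul hB hΔ hR qc qs, fun _ h => h.eq_transportComul hB hΔ hR⟩

end

theorem ldiagOf_isHopfAlgebra {K : Type u} [CommRing K] (c : Colour) :
    (ldiagOf K c).IsHopfAlgebra :=
  ldiag_isConnectedBialgebra.isHopfAlgebra.of_isIsomorphic (ldiagOf_isIsomorphic c)

end Feynman

end

theorem mainTheorem1 {K : Type*} [CommRing K] :
    -- the span of the codes of diagrams is closed under the shifted twisted product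
    (∀ (qc qs : K) (d e : Feynman.LDiag),
      Finsupp.mapDomain Feynman.LDiag.code
          (Feynman.deformedMul qc qs (Finsupp.single d 1) (Finsupp.single e 1)) =
        Feynman.shiftedTwisted qc qs d.code e.code) ∧
    ∀ c : Feynman.Colour,
      -- the coproduct is well defined, and one gets a Hopf algebra
      (∀ qc qs qt : K, qt = 0 ∨ qt = 1 →
        (∃! Δ, Feynman.IsDeformedComul c qc qs qt Δ) ∧
        ∀ Δ, Feynman.IsDeformedComul c qc qs qt Δ →
          (Feynman.ldiagDeformed qc qs Δ).IsHopfAlgebra) ∧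
      -- parameters (0, 0, 0)
      (∀ Δ, Feynman.IsDeformedComul c (0 : K) 0 0 Δ →
        (Feynman.ldiagDeformed (0 : K) 0 Δ).IsIsomorphic (Feynman.ldiag K)) ∧
      -- parameters (1, 1, 1)
      (∀ Δ, Feynman.IsDeformedComul c (1 : K) 1 1 Δ →
        (Feynman.ldiagDeformed (1 : K) 1 Δ).IsIsomorphic (Feynman.mqsym K)) := by
  open Feynman in
  refine ⟨mapDomain_code_deformedMul, fun c => ?_⟩
  have h0 := isDeformedAlgebra_ldiagOf (K := K) c
  have h0' := comulIsAlgHom_ldiagOf (K := K) c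
  have h0'' := isReference_ldiagOf (K := K) c
  have h1 := isDeformedAlgebra_mqsym (K := K)
  have h1' := comulIsAlgHom_mqsym (K := K)
  have h1'' := isReference_mqsym (K := K) c
  refine ⟨?_, fun Δ h => (h.isIsomorphic h0 h0' h0'').trans (ldiagOf_isIsomorphic c),
    fun Δ h => h.isIsomorphic h1 h1' h1''⟩
  -- The two values of `q_t` are those for which the interpolated constants belong to a reference
  -- structure, `ldiagOf K c` or `mqsym K`, from which the Hopf property is pulled back.
  rintro qc qs qt (rfl | rfl)
  · exact ⟨existsUnique_isDeformedComul h0 h0' h0'', fun Δ h =>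
      (ldiagOf_isHopfAlgebra c).of_isIsomorphic (h.isIsomorphic h0 h0' h0'')⟩
  · exact ⟨existsUnique_isDeformedComul h1 h1' h1'', fun Δ h =>
      mqsym_isConnectedBialgebra.isHopfAlgebra.of_isIsomorphic (h.isIsomorphic h1 h1' h1'')⟩
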